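/- Let $F$ be an algebraically closed field of characteristic $2$. For $\alpha \in F$ let $\varphi_\alpha : F \cup \{\infty\} \to F \cup \{\infty\}$ be the map $t \mapsto t^4 + \alpha t^{-4}$ for $t \in F \setminus \{0\}$, with $\varphi_\alpha(0) = \varphi_\alpha(\infty) = \infty$, and let $\varphi_\alpha^{(r)}$ denote its $r$-fold iterate. The escape time $\ell_\alpha$ of $\alpha$ is the integer $r \ge 1$ with $\varphi_\alpha^{(r)}(1) = 0$ (there is at most one), and $\ell_\alpha = \infty$ if there is no such $r$. Let $\alpha \in F$ be nonzero with finite escape time $\ell_\alpha = \ell$, and set $Q = 2^{2\ell - 1}$, $\mathcal{O} = F[x,y,z]/(x^{4Q}, y^{4Q}, z^{4Q})$ and $h_\alpha = \alpha z^4 + (x^2 + yz)(y^2 + xz)$. Then the image $v$ of $xy\,(y^3z^3)^Q$ in $\mathcal{O}$ is not a multiple of (the image of) $h_\alpha$, that is, $v \notin h_\alpha \mathcal{O}$. -/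

import Mathlib

open MvPolynomial
open scoped OnePoint

/-- The self-map `t ↦ t ^ 4 + α * t ^ (-4)` of `F ∪ {∞}`; the points `0` and `∞` are sent
to `∞`. -/
noncomputable def phiMap {F : Type*} [Field F] (α : F) (t : OnePoint F) : OnePoint F :=
  open Classical in
  t.elim ∞ fun s => if s = 0 then ∞ else ((s ^ 4 + α * (s ^ 4)⁻¹ : F) : OnePoint F)

/-- The escape time of `α`: the `r ≥ 1` for which the `r`-fold iterate of `phiMap α` takes `1` to
`0` (there is at most one such `r`), and `⊤` if there is none. -/
noncomputable def escapeTime {F : Type*} [Field F] (α : F) : ℕ∞ :=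
  sInf {n : ℕ∞ | ∃ r : ℕ, n = r ∧ 1 ≤ r ∧
    (phiMap α)^[r] ((1 : F) : OnePoint F) = ((0 : F) : OnePoint F)}

/-- The quartic form `α z ^ 4 + (x ^ 2 + y z) (y ^ 2 + x z)`, the variables `x, y, z` being
`X 0, X 1, X 2`. -/
noncomputable def hQuartic {F : Type*} [Field F] (α : F) : MvPolynomial (Fin 3) F :=
  C α * X 2 ^ 4 + (X 0 ^ 2 + X 1 * X 2) * (X 1 ^ 2 + X 0 * X 2)

/-- The ideal `(x ^ m, y ^ m, z ^ m)` of `F[x, y, z]`. -/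
noncomputable def powerIdeal (F : Type*) [Field F] (m : ℕ) : Ideal (MvPolynomial (Fin 3) F) :=
  Ideal.span {X 0 ^ m, X 1 ^ m, X 2 ^ m}

/-! Put z = 1. On the curve h = 0 the function A = x² + y is a unit, since A(y² + x) = α, and the
coordinate ring becomes the extension x⁴ + x = A² + αA⁻¹ of F[A, A⁻¹]. It has two points at
infinity, one over A = ∞ and one over A = 0. If the theorem failed, the part of degree 6Q + 2 would
give a relation u x^(4Q) + v y^(4Q) + w = xy·y^(3Q) on the curve, where u, v, w come from degree 2Q
+ 2 and so have bounded poles (`gradedEval_hQuartic`, `coeff_gradedEval_mem_poleBounded`).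

Frobenius gives x^(4Q) = x² + X and y^(4Q) = x + Y with Laurent polynomials X, Y in A, so each pair
(a, b) of Laurent polynomials yields a x^(4Q) + b y^(4Q) = a x² + b x + (aX + bY). There are two
pairs for which a, b and aX + bY have exponents in [-Q, Q]. Passing from Q to 4Q (`IsBalanced.step`)
moves the extreme coefficients of aX + bY along the orbit of 1 under φ, up to squaring and powers of
α (`exists_isBalanced`). At the escape time they vanish, and a shift by A⁻¹ then produces a pair of
exceptionally small size (`IsBalanced.exists_odd`).

For this pair let l = av + bu, and look at the coefficient of A⁰ in the trace of l. Pole estimates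
at A = ∞ make it zero (`trace_coeff_zero_eq_zero`). Estimates at A = 0 make it nonzero
(`trace_coeff_zero_ne_zero`), the decisive term being isolated by the parity of exponents
(`coeff_mul_tail_ne_zero`). -/

open scoped LaurentPolynomial

/-! ### Laurent polynomials with restricted exponents -/

/-- The Laurent polynomials all of whose exponents lie in `s`. -/
def LaurentPolynomial.supportedOn (F : Type*) [Field F] (s : Set ℤ) : Submodule F F[T;T⁻¹] where
  carrier := {f | ∀ n, f.coeff n ≠ 0 → n ∈ s}
  zero_mem' := by intro n hn; simp at hn
  add_mem' := by
    intro f g hf hg n hn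
    by_contra hns
    exact hn (by
      rw [AddMonoidAlgebra.coeff_add, Finsupp.add_apply, not_imp_comm.1 (hf n) hns,
        not_imp_comm.1 (hg n) hns, add_zero])
  smul_mem' := by
    intro c f hf n hn
    refine hf n fun h => hn ?_
    rw [AddMonoidAlgebra.coeff_smul, Finsupp.smul_apply, h, smul_zero]

/-- The Laurent polynomials all of whose exponents `n` satisfy `s * n ≤ m`. -/
abbrev LaurentPolynomial.bounded (F : Type*) [Field F] (s m : ℤ) : Submodule F F[T;T⁻¹] :=
  supportedOn F {n | s * n ≤ m}

namespace LaurentPolynomial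

variable {F : Type*} [Field F] {f g : F[T;T⁻¹]} {s t u : Set ℤ}

lemma coeff_eq_zero_of_mem_supportedOn (hf : f ∈ supportedOn F s) {n : ℤ} (hn : n ∉ s) :
    f.coeff n = 0 := not_imp_comm.1 (hf n) hn

lemma mul_mem_supportedOn (hf : f ∈ supportedOn F s) (hg : g ∈ supportedOn F t)
    (h : ∀ m ∈ s, ∀ n ∈ t, m + n ∈ u) : f * g ∈ supportedOn F u := by
  classical
  intro n hn
  have hn' := AddMonoidAlgebra.support_coeff_mul_subset f g (Finsupp.mem_support_iff.2 hn)
  obtain ⟨i, hi, j, hj, rfl⟩ := Finset.mem_add.1 hn'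
  exact h i (hf i (Finsupp.mem_support_iff.1 hi)) j (hg j (Finsupp.mem_support_iff.1 hj))

lemma supportedOn_mono (h : s ⊆ t) (hf : f ∈ supportedOn F s) : f ∈ supportedOn F t :=
  fun n hn => h (hf n hn)

lemma T_mem_supportedOn {n : ℤ} (h : n ∈ s) : T n ∈ supportedOn F s := by
  intro m hm
  rw [T_apply] at hm
  obtain rfl : n = m := by by_contra hne; simp [hne] at hm
  exact h

lemma C_mul_mem_supportedOn (c : F) (hf : f ∈ supportedOn F s) : C c * f ∈ supportedOn F s := by
  rw [← smul_eq_C_mul]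
  exact Submodule.smul_mem _ c hf

lemma coeff_C_mul (c : F) (f : F[T;T⁻¹]) (n : ℤ) : (C c * f).coeff n = c * f.coeff n := by
  rw [← smul_eq_C_mul, AddMonoidAlgebra.coeff_smul, Finsupp.smul_apply, smul_eq_mul]

lemma coeff_T_mul (m : ℤ) (f : F[T;T⁻¹]) (n : ℤ) : (T m * f).coeff n = f.coeff (n - m) := by
  exact AddMonoidAlgebra.coeff_single_mul_eq_mul_coeff (n - m) (fun _ _ => by omega) |>.trans (one_mul _)

section bounded

variable {e m n k : ℤ}

lemma coeff_eq_zero_of_mem_bounded (hf : f ∈ bounded F e m) (h : m < e * n) : f.coeff n = 0 :=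
  coeff_eq_zero_of_mem_supportedOn hf (not_le.2 h)

lemma bounded_mono (h : m ≤ n) (hf : f ∈ bounded F e m) : f ∈ bounded F e n :=
  supportedOn_mono (fun _ hi => le_trans hi h) hf

lemma mul_mem_bounded (hf : f ∈ bounded F e m) (hg : g ∈ bounded F e n) (h : m + n ≤ k) :
    f * g ∈ bounded F e k :=
  mul_mem_supportedOn hf hg fun i hi j hj => by
    simp only [Set.mem_ofPred_eq] at *
    linarith [mul_add e i j]

lemma T_mem_bounded (h : e * n ≤ m) : T n ∈ bounded F e m := T_mem_supportedOn h

lemma one_mem_bounded (h : 0 ≤ m) : 1 ∈ bounded F e m := T_mem_bounded (n := 0) (by simpa)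

lemma pow_mem_bounded (hf : f ∈ bounded F e m) (j : ℕ) (h : j * m ≤ n) :
    f ^ j ∈ bounded F e n := by
  refine bounded_mono h ?_
  clear h
  induction j with
  | zero => simpa using one_mem_bounded le_rfl
  | succ j ih => rw [pow_succ]; exact mul_mem_bounded ih hf (by push_cast; linarith)

lemma C_mul_T_mul_pow_mem_bounded (hf : f ∈ bounded F e m) (c : F) (i : ℤ) (j : ℕ)
    (h : e * i + j * m ≤ n) : C c * T i * f ^ j ∈ bounded F e n := by
  rw [mul_assoc]
  exact C_mul_mem_supportedOn c
    (mul_mem_bounded (T_mem_bounded le_rfl) (pow_mem_bounded hf j le_rfl) h)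

end bounded

end LaurentPolynomial

/-! ### Frobenius tails and balanced pairs -/

lemma add_pow_four_of_two_eq_zero {R : Type*} [CommRing R] (h : (2 : R) = 0) (a b : R) :
    (a + b) ^ 4 = a ^ 4 + b ^ 4 := by
  linear_combination (2 * a ^ 3 * b + 3 * a ^ 2 * b ^ 2 + 2 * a * b ^ 3) * h

namespace LaurentPolynomial

variable {F : Type*} [Field F]

lemma two_eq_zero [CharP F 2] : (2 : F[T;T⁻¹]) = 0 := by
  rw [← map_ofNat C, CharTwo.two_eq_zero, map_zero]

/-- The Laurent polynomial `X` in `A` with `x ^ (2 * 4 ^ k) = x ^ 2 + X`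
whenever `x ^ 4 + x = A ^ 2 + α * A⁻¹`. -/
noncomputable def xTail (α : F) : ℕ → F[T;T⁻¹]
  | 0 => 0
  | k + 1 => xTail α k ^ 4 + (T 2 + C α * T (-1)) ^ 2

/-- The Laurent polynomial `Y` in `A` with `y ^ (2 * 4 ^ k) = x + Y`
whenever `y ^ 2 = x + α * A⁻¹` and `x ^ 4 + x = A ^ 2 + α * A⁻¹`. -/
noncomputable def yTail (α : F) : ℕ → F[T;T⁻¹]
  | 0 => C α * T (-1)
  | k + 1 => yTail α k ^ 4 + (T 2 + C α * T (-1))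

/-- Two pairs `(a₁, b₁)`, `(a₂, b₂)` of Laurent polynomials such that, up to terms of lower order,
the triples `(aᵢ, bᵢ, aᵢ * X + bᵢ * Y)` have their exponents in `[-Q, Q]`, with prescribed
extreme coefficients. -/
structure IsBalanced (X Y : F[T;T⁻¹]) (Q : ℤ) (c₁ c₂ : F) (a₁ b₁ a₂ b₂ : F[T;T⁻¹]) : Prop where
  a₁_top : a₁ ∈ bounded F 1 (Q - 2)
  a₁_bot : a₁ ∈ bounded F (-1) (Q - 2)
  a₁_coeff : a₁.coeff (2 - Q) ≠ 0
  a₁_even : a₁ ∈ supportedOn F {n | Even n}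
  b₁_top : b₁ - T Q ∈ bounded F 1 (Q - 2)
  b₁_bot : b₁ ∈ bounded F (-1) (Q - 2)
  e₁_top : a₁ * X + b₁ * Y ∈ bounded F 1 (Q - 1)
  e₁_bot : a₁ * X + b₁ * Y - C c₁ * T (-Q) ∈ bounded F (-1) (Q - 2)
  a₂_top : a₂ ∈ bounded F 1 (Q - 2)
  a₂_bot : a₂ - T (-Q) ∈ bounded F (-1) (Q - 2)
  a₂_even : a₂ ∈ supportedOn F {n | Even n}
  b₂_top : b₂ ∈ bounded F 1 (Q - 2)
  b₂_bot : b₂ ∈ bounded F (-1) (Q - 2)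
  e₂_top : a₂ * X + b₂ * Y - C c₂ * T Q ∈ bounded F 1 (Q - 1)
  e₂_bot : a₂ * X + b₂ * Y ∈ bounded F (-1) (Q - 1)

lemma mul_mem_even {f g : F[T;T⁻¹]} (hf : f ∈ supportedOn F {n | Even n})
    (hg : g ∈ supportedOn F {n | Even n}) : f * g ∈ supportedOn F {n | Even n} :=
  mul_mem_supportedOn hf hg fun _ hm _ hn => Even.add hm hn

lemma pow_mem_even {f : F[T;T⁻¹]} (hf : f ∈ supportedOn F {n | Even n}) (j : ℕ) :
    f ^ j ∈ supportedOn F {n | Even n} := by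
  induction j with
  | zero => exact T_mem_supportedOn (n := 0) (by simp)
  | succ j ih => rw [pow_succ]; exact mul_mem_even ih hf

/-- The start of the recursion, at Q = 2. The factor 1 + α = φ(1) in both extreme coefficients is
the first point of the orbit. -/
lemma isBalanced_one [CharP F 2] {α : F} (hα : α ≠ 0) :
    IsBalanced (xTail α 1) (yTail α 1) 2 (α ^ 2 * (1 + α) ^ 2) ((α ^ 2)⁻¹ * (1 + α) ^ 2)
      1 (T 2) (T (-2)) (C (α ^ 2)⁻¹) := by
  have h2 : (2 : F[T;T⁻¹]) = 0 := two_eq_zero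
  have hA : (T 1 * T (-1) : F[T;T⁻¹]) = 1 := by rw [← T_add]; simp
  have hT : ∀ n : ℕ, (T n : F[T;T⁻¹]) = T 1 ^ n := fun n => by simp
  have hT' : ∀ n : ℕ, (T (-n) : F[T;T⁻¹]) = T (-1) ^ n := fun n => by simp
  have hC : (C α * C α⁻¹ : F[T;T⁻¹]) = 1 := by rw [← map_mul, mul_inv_cancel₀ hα, map_one]
  have t2 := hT 2
  have t2' := hT' 2
  have t4' := hT' 4
  push_cast at t2 t2' t4'
  have e₁ : 1 * xTail α 1 + T 2 * yTail α 1 =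
      C (α ^ 2 * (1 + α) ^ 2) * T (-2) + C α * T 1 := by
    simp only [xTail, yTail, t2, t2', map_mul, map_pow, map_add, map_one]
    generalize (T 1 : F[T;T⁻¹]) = A at *
    generalize (T (-1) : F[T;T⁻¹]) = B at *
    generalize C α = c at *
    linear_combination (A ^ 4 + c * A ^ 2 * B - c ^ 3 * B ^ 2) * h2 +
      (c ^ 4 * B ^ 2 * (A * B + 1) + c * A) * hA
  have e₂ : T (-2) * xTail α 1 + C (α ^ 2)⁻¹ * yTail α 1 =
      C ((α ^ 2)⁻¹ * (1 + α) ^ 2) * T 2 + C α⁻¹ * T (-1) := by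
    simp only [xTail, yTail, t2, t2', map_mul, map_pow, map_add, map_one, ← inv_pow]
    generalize (T 1 : F[T;T⁻¹]) = A at *
    generalize (T (-1) : F[T;T⁻¹]) = B at *
    generalize C α = c at *
    generalize C α⁻¹ = d at *
    linear_combination (B ^ 3 * A ^ 2 * c - A ^ 2 * c * d ^ 2 + B ^ 4 * c ^ 2) * h2 +
      (B * d + B ^ 4 * c ^ 2 * (c * d + 1) - A ^ 2 * (c * d + 1)) * hC + A ^ 2 * (A * B + 1) * hA
  constructor
  · exact one_mem_bounded le_rfl
  · exact one_mem_bounded le_rfl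
  · rw [← T_zero]; simp
  · exact T_mem_supportedOn (n := 0) (by simp)
  · rw [sub_self (T _)]; exact Submodule.zero_mem _
  · exact T_mem_bounded (by norm_num)
  · rw [e₁]
    exact add_mem (C_mul_mem_supportedOn _ (T_mem_bounded (by norm_num)))
      (C_mul_mem_supportedOn _ (T_mem_bounded (by norm_num)))
  · rw [e₁, add_sub_cancel_left]
    exact C_mul_mem_supportedOn _ (T_mem_bounded (by norm_num))
  · exact T_mem_bounded (by norm_num)
  · rw [sub_self (T _)]; exact Submodule.zero_mem _
  · exact T_mem_supportedOn (by simp)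
  · rw [← mul_one (C _)]; exact C_mul_mem_supportedOn _ (one_mem_bounded le_rfl)
  · rw [← mul_one (C _)]; exact C_mul_mem_supportedOn _ (one_mem_bounded le_rfl)
  · rw [e₂, add_sub_cancel_left]
    exact C_mul_mem_supportedOn _ (T_mem_bounded (by norm_num))
  · rw [e₂]
    exact add_mem (C_mul_mem_supportedOn _ (T_mem_bounded (by norm_num)))
      (C_mul_mem_supportedOn _ (T_mem_bounded (by norm_num)))

/-- Fourth powers of a balanced pair almost work for 4Q, but the new summands of X' and Y' create
one term too far out: A^(4Q+2) from b₁⁴ in the first pair, A^(-4Q-2) from a₂⁴ in the second. Each is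
cancelled by a multiple of the fourth power of the other pair, and this correction feeds the inverse
of the other extreme coefficient into the new one. -/
lemma IsBalanced.step [CharP F 2] {α : F} {X Y X' Y' a₁ b₁ a₂ b₂ : F[T;T⁻¹]} {Q : ℤ} {c₁ c₂ : F}
    (h : IsBalanced X Y Q c₁ c₂ a₁ b₁ a₂ b₂) (hc₁ : c₁ ≠ 0) (hc₂ : c₂ ≠ 0)
    (hX : X' = X ^ 4 + (T 2 + C α * T (-1)) ^ 2) (hY : Y' = Y ^ 4 + (T 2 + C α * T (-1))) :
    IsBalanced X' Y' (4 * Q) (c₁ ^ 4 + α ^ 2 * (c₂ ^ 4)⁻¹) (c₂ ^ 4 + α ^ 2 * (c₁ ^ 4)⁻¹)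
      (a₁ ^ 4 + C (c₂ ^ 4)⁻¹ * T 2 * a₂ ^ 4) (b₁ ^ 4 + C (c₂ ^ 4)⁻¹ * T 2 * b₂ ^ 4)
      (a₂ ^ 4 + C (α ^ 2 * (c₁ ^ 4)⁻¹) * T (-2) * a₁ ^ 4)
      (b₂ ^ 4 + C (α ^ 2 * (c₁ ^ 4)⁻¹) * T (-2) * b₁ ^ 4) := by
  have h2 : (2 : F[T;T⁻¹]) = 0 := two_eq_zero
  have add4 := add_pow_four_of_two_eq_zero h2
  obtain ⟨ha₁, ha₁', ha₁c, ha₁e, hb₁, hb₁', he₁, he₁', ha₂, ha₂', ha₂e, hb₂, hb₂', he₂, he₂'⟩ := h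
  set e₁ := a₁ * X + b₁ * Y with e₁_def
  set e₂ := a₂ * X + b₂ * Y with e₂_def
  -- κA² times the top term c₂⁴A^(4Q) of e₂⁴ is A^(4Q+2); μA⁻² times the bottom term c₁⁴A^(-4Q) of
  -- e₁⁴ is α²A^(-4Q-2).
  set κ := (c₂ ^ 4)⁻¹ with hκ
  set μ := α ^ 2 * (c₁ ^ 4)⁻¹ with hμ
  have Cκ : (C κ * C c₂ ^ 4 : F[T;T⁻¹]) = 1 := by
    rw [← map_pow, ← map_mul, hκ, inv_mul_cancel₀ (pow_ne_zero _ hc₂), map_one]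
  have Cμ : (C μ * C c₁ ^ 4 : F[T;T⁻¹]) = C α ^ 2 := by
    rw [← map_pow, ← map_mul, hμ, inv_mul_cancel_right₀ (pow_ne_zero _ hc₁), map_pow]
  obtain ⟨r₁, hr₁⟩ : ∃ r, b₁ = T Q + r := ⟨b₁ - T Q, by ring⟩
  obtain ⟨r₂, hr₂⟩ : ∃ r, a₂ = T (-Q) + r := ⟨a₂ - T (-Q), by ring⟩
  obtain ⟨s₁, hs₁⟩ : ∃ r, e₁ = C c₁ * T (-Q) + r := ⟨e₁ - C c₁ * T (-Q), by ring⟩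
  obtain ⟨s₂, hs₂⟩ : ∃ r, e₂ = C c₂ * T Q + r := ⟨e₂ - C c₂ * T Q, by ring⟩
  rw [hs₁, add_sub_cancel_left] at he₁'
  rw [hs₂, add_sub_cancel_left] at he₂
  rw [hr₁, add_sub_cancel_left] at hb₁
  rw [hr₂, add_sub_cancel_left] at ha₂'
  have TT : ∀ m n k : ℤ, k = m + n → (T m * T n : F[T;T⁻¹]) = T k := fun m n k h => by
    rw [h, T_add]
  have T4 : ∀ n : ℤ, (T n ^ 4 : F[T;T⁻¹]) = T (4 * n) := fun n => by simp
  have hr₁4 : b₁ ^ 4 = T (4 * Q) + r₁ ^ 4 := by rw [hr₁, add4, T4]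
  have hr₂4 : a₂ ^ 4 = T (-(4 * Q)) + r₂ ^ 4 := by rw [hr₂, add4, T4, mul_neg]
  have hs₁4 : e₁ ^ 4 = C c₁ ^ 4 * T (-(4 * Q)) + s₁ ^ 4 := by
    rw [hs₁, add4, mul_pow, T4, mul_neg]
  have hs₂4 : e₂ ^ 4 = C c₂ ^ 4 * T (4 * Q) + s₂ ^ 4 := by rw [hs₂, add4, mul_pow, T4]
  have g2 : (T 2 + C α * T (-1) : F[T;T⁻¹]) ^ 2 = T 4 + C (α ^ 2) * T (-2) := by
    rw [map_pow]
    linear_combination (T 2 * C α * T (-1)) * h2 + TT 2 2 4 rfl + C α ^ 2 * TT (-1) (-1) (-2) rfl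
  have E₁ : a₁ ^ 4 * X' + b₁ ^ 4 * Y' =
      e₁ ^ 4 + a₁ ^ 4 * (T 4 + C (α ^ 2) * T (-2)) + b₁ ^ 4 * (T 2 + C α * T (-1)) := by
    rw [hX, hY, g2, e₁_def, add4]; ring
  have E₂ : a₂ ^ 4 * X' + b₂ ^ 4 * Y' =
      e₂ ^ 4 + a₂ ^ 4 * (T 4 + C (α ^ 2) * T (-2)) + b₂ ^ 4 * (T 2 + C α * T (-1)) := by
    rw [hX, hY, g2, e₂_def, add4]; ring
  have E₁' : (a₁ ^ 4 + C κ * T 2 * a₂ ^ 4) * X' + (b₁ ^ 4 + C κ * T 2 * b₂ ^ 4) * Y' =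
      e₁ ^ 4 + a₁ ^ 4 * (T 4 + C (α ^ 2) * T (-2)) + b₁ ^ 4 * (T 2 + C α * T (-1)) +
      C κ * (T 2 * e₂ ^ 4 + a₂ ^ 4 * (T 6 + C (α ^ 2)) + b₂ ^ 4 * (T 4 + C α * T 1)) := by
    linear_combination E₁ + C κ * T 2 * E₂ + C κ * (a₂ ^ 4 * (TT 2 4 6 rfl +
      C (α ^ 2) * (TT 2 (-2) 0 rfl).trans T_zero) + b₂ ^ 4 * (TT 2 2 4 rfl +
      C α * TT 2 (-1) 1 rfl))
  have E₂' : (a₂ ^ 4 + C μ * T (-2) * a₁ ^ 4) * X' + (b₂ ^ 4 + C μ * T (-2) * b₁ ^ 4) * Y' =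
      e₂ ^ 4 + a₂ ^ 4 * (T 4 + C (α ^ 2) * T (-2)) + b₂ ^ 4 * (T 2 + C α * T (-1)) +
      C μ * (T (-2) * e₁ ^ 4 + a₁ ^ 4 * (T 2 + C (α ^ 2) * T (-4)) +
        b₁ ^ 4 * (1 + C α * T (-3))) := by
    linear_combination E₂ + C μ * T (-2) * E₁ + C μ * (a₁ ^ 4 * (TT (-2) 4 2 rfl +
      C (α ^ 2) * (TT (-2) (-2) (-4) rfl)) + b₁ ^ 4 * ((TT (-2) 2 0 rfl).trans T_zero +
      C α * TT (-2) (-1) (-3) rfl))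
  have pw : ∀ {f : F[T;T⁻¹]} {e m : ℤ} (n : ℤ), f ∈ bounded F e m → 4 * m ≤ n →
      f ^ 4 ∈ bounded F e n := fun n hf h => pow_mem_bounded hf 4 (by push_cast; exact h)
  have tm : ∀ {f : F[T;T⁻¹]} {e m : ℤ} (n : ℤ) (c : F) (i : ℤ), f ∈ bounded F e m →
      e * i + 4 * m ≤ n → C c * T i * f ^ 4 ∈ bounded F e n :=
    fun n c i hf h => C_mul_T_mul_pow_mem_bounded hf c i 4 (by push_cast; exact h)
  have ct : ∀ {e : ℤ} (n : ℤ) (c : F) (i : ℤ), e * i ≤ n → C c * T i ∈ bounded F e n :=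
    fun n c i h => C_mul_mem_supportedOn c (T_mem_bounded h)
  have aux_even : ∀ {f g : F[T;T⁻¹]} (c : F) (i : ℤ), Even i → f ∈ supportedOn F {n | Even n} →
      g ∈ supportedOn F {n | Even n} → f ^ 4 + C c * T i * g ^ 4 ∈ supportedOn F {n | Even n} :=
    fun c i hi hf hg => add_mem (pow_mem_even hf 4) (mul_mem_even
      (C_mul_mem_supportedOn c (T_mem_supportedOn hi)) (pow_mem_even hg 4))
  have ha₂b : a₂ ∈ bounded F (-1) Q := by
    rw [hr₂]; exact add_mem (T_mem_bounded (by omega)) (bounded_mono (by omega) ha₂')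
  have hb₁t : b₁ ∈ bounded F 1 Q := by
    rw [hr₁]; exact add_mem (T_mem_bounded (by omega)) (bounded_mono (by omega) hb₁)
  refine ⟨?_, ?_, ?_, ?_, ?_, ?_, ?_, ?_, ?_, ?_, ?_, ?_, ?_, ?_, ?_⟩
  · exact add_mem (pw _ ha₁ (by omega)) (tm _ _ _ ha₂ (by omega))
  · exact add_mem (pw _ ha₁' (by omega)) (tm _ _ _ ha₂b (by omega))
  -- The only contribution is κA² times the leading term A^(-4Q) of a₂⁴, so the coefficient is κ.
  · have z₁ : (a₁ ^ 4).coeff (2 - 4 * Q) = 0 :=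
      coeff_eq_zero_of_mem_bounded (pw (4 * Q - 8) ha₁' (by omega)) (by omega)
    have z₂ : (r₂ ^ 4).coeff (2 - 4 * Q - 2) = 0 :=
      coeff_eq_zero_of_mem_bounded (pw (4 * Q - 8) ha₂' (by omega)) (by omega)
    rw [hr₂4, AddMonoidAlgebra.coeff_add, Finsupp.add_apply, z₁, mul_assoc, coeff_C_mul,
      coeff_T_mul, AddMonoidAlgebra.coeff_add, Finsupp.add_apply, z₂, T_apply, if_pos (by ring),
      zero_add, add_zero, mul_one]
    exact inv_ne_zero (pow_ne_zero _ hc₂)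
  · exact aux_even _ _ (by decide) ha₁e ha₂e
  · rw [hr₁4, add_assoc, add_sub_cancel_left]
    exact add_mem (pw _ hb₁ (by omega)) (tm _ _ _ hb₂ (by omega))
  · exact add_mem (pw _ hb₁' (by omega)) (tm _ _ _ hb₂' (by omega))
  · have key : (a₁ ^ 4 + C κ * T 2 * a₂ ^ 4) * X' + (b₁ ^ 4 + C κ * T 2 * b₂ ^ 4) * Y' =
        e₁ ^ 4 + C 1 * T 4 * a₁ ^ 4 + C (α ^ 2) * T (-2) * a₁ ^ 4 + C 1 * T 2 * r₁ ^ 4 +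
          C α * T (-1) * r₁ ^ 4 + C α * T (4 * Q - 1) + C κ * T 2 * s₂ ^ 4 +
          C κ * T 6 * a₂ ^ 4 + C (κ * α ^ 2) * T 0 * a₂ ^ 4 + C κ * T 4 * b₂ ^ 4 +
          C (κ * α) * T 1 * b₂ ^ 4 := by
      rw [E₁', hr₁4, hs₂4]
      simp only [map_mul, map_one, T_zero]
      linear_combination C α * TT (4 * Q) (-1) (4 * Q - 1) (by ring) + T 2 * T (4 * Q) * Cκ +
        T 2 * T (4 * Q) * h2
    rw [key]
    refine add_mem (add_mem (add_mem (add_mem (add_mem (add_mem (add_mem (add_mem (add_mem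
      (add_mem (pw _ he₁ ?_) (tm _ _ _ ha₁ ?_)) (tm _ _ _ ha₁ ?_)) (tm _ _ _ hb₁ ?_))
      (tm _ _ _ hb₁ ?_)) (ct _ _ _ ?_)) (tm _ _ _ he₂ ?_)) (tm _ _ _ ha₂ ?_)) (tm _ _ _ ha₂ ?_))
      (tm _ _ _ hb₂ ?_)) (tm _ _ _ hb₂ ?_) <;> omega
  · have key : (a₁ ^ 4 + C κ * T 2 * a₂ ^ 4) * X' + (b₁ ^ 4 + C κ * T 2 * b₂ ^ 4) * Y' -
          C (c₁ ^ 4 + α ^ 2 * κ) * T (-(4 * Q)) =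
        s₁ ^ 4 + C 1 * T 4 * a₁ ^ 4 + C (α ^ 2) * T (-2) * a₁ ^ 4 + C 1 * T 2 * b₁ ^ 4 +
          C α * T (-1) * b₁ ^ 4 + C κ * T 2 * e₂ ^ 4 +
          C κ * T 6 * a₂ ^ 4 + C (κ * α ^ 2) * T 0 * r₂ ^ 4 + C κ * T 4 * b₂ ^ 4 +
          C (κ * α) * T 1 * b₂ ^ 4 := by
      rw [E₁', hs₁4]
      simp only [map_mul, map_one, map_add, map_pow, T_zero]
      linear_combination C κ * C α ^ 2 * hr₂4
    rw [key]
    refine add_mem (add_mem (add_mem (add_mem (add_mem (add_mem (add_mem (add_mem (add_mem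
      (pw _ he₁' ?_) (tm _ _ _ ha₁' ?_)) (tm _ _ _ ha₁' ?_)) (tm _ _ _ hb₁' ?_))
      (tm _ _ _ hb₁' ?_)) (tm _ _ _ he₂' ?_)) (tm _ _ _ ha₂b ?_)) (tm _ _ _ ha₂' ?_))
      (tm _ _ _ hb₂' ?_)) (tm _ _ _ hb₂' ?_) <;> omega
  · exact add_mem (pw _ ha₂ (by omega)) (tm _ _ _ ha₁ (by omega))
  · rw [hr₂4, add_assoc, add_sub_cancel_left]
    exact add_mem (pw _ ha₂' (by omega)) (tm _ _ _ ha₁' (by omega))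
  · exact aux_even _ _ (by decide) ha₂e ha₁e
  · exact add_mem (pw _ hb₂ (by omega)) (tm _ _ _ hb₁t (by omega))
  · exact add_mem (pw _ hb₂' (by omega)) (tm _ _ _ hb₁' (by omega))
  · have key : (a₂ ^ 4 + C μ * T (-2) * a₁ ^ 4) * X' + (b₂ ^ 4 + C μ * T (-2) * b₁ ^ 4) * Y' -
          C (c₂ ^ 4 + μ) * T (4 * Q) =
        s₂ ^ 4 + C 1 * T 4 * a₂ ^ 4 + C (α ^ 2) * T (-2) * a₂ ^ 4 + C 1 * T 2 * b₂ ^ 4 +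
          C α * T (-1) * b₂ ^ 4 + C μ * T (-2) * e₁ ^ 4 +
          C μ * T 2 * a₁ ^ 4 + C (μ * α ^ 2) * T (-4) * a₁ ^ 4 + C μ * T 0 * r₁ ^ 4 +
          C (μ * α) * T (-3) * b₁ ^ 4 := by
      rw [E₂', hs₂4]
      simp only [map_mul, map_one, map_add, map_pow, T_zero]
      linear_combination C μ * hr₁4
    rw [key]
    refine add_mem (add_mem (add_mem (add_mem (add_mem (add_mem (add_mem (add_mem (add_mem
      (pw _ he₂ ?_) (tm _ _ _ ha₂ ?_)) (tm _ _ _ ha₂ ?_)) (tm _ _ _ hb₂ ?_))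
      (tm _ _ _ hb₂ ?_)) (tm _ _ _ he₁ ?_)) (tm _ _ _ ha₁ ?_)) (tm _ _ _ ha₁ ?_))
      (tm _ _ _ hb₁ ?_)) (tm _ _ _ hb₁t ?_) <;> omega
  · have key : (a₂ ^ 4 + C μ * T (-2) * a₁ ^ 4) * X' + (b₂ ^ 4 + C μ * T (-2) * b₁ ^ 4) * Y' =
        e₂ ^ 4 + C 1 * T 4 * a₂ ^ 4 + C (α ^ 2) * T (-2) * r₂ ^ 4 + C 1 * T 2 * b₂ ^ 4 +
          C α * T (-1) * b₂ ^ 4 + C μ * T (-2) * s₁ ^ 4 +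
          C μ * T 2 * a₁ ^ 4 + C (μ * α ^ 2) * T (-4) * a₁ ^ 4 + C μ * T 0 * b₁ ^ 4 +
          C (μ * α) * T (-3) * b₁ ^ 4 := by
      rw [E₂', hs₁4]
      simp only [map_mul, map_one, map_pow, T_zero]
      linear_combination C α ^ 2 * T (-2) * hr₂4 + T (-2) * T (-(4 * Q)) * Cμ +
        C α ^ 2 * T (-2) * T (-(4 * Q)) * h2
    rw [key]
    refine add_mem (add_mem (add_mem (add_mem (add_mem (add_mem (add_mem (add_mem (add_mem
      (pw _ he₂' ?_) (tm _ _ _ ha₂b ?_)) (tm _ _ _ ha₂' ?_)) (tm _ _ _ hb₂' ?_))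
      (tm _ _ _ hb₂' ?_)) (tm _ _ _ he₁' ?_)) (tm _ _ _ ha₁' ?_)) (tm _ _ _ ha₁' ?_))
      (tm _ _ _ hb₁' ?_)) (tm _ _ _ hb₁' ?_) <;> omega

end LaurentPolynomial

/-! ### The orbit of 1 up to the escape time -/

section escape

variable {F : Type*} [Field F] {α : F}

lemma phiMap_infty : phiMap α ∞ = ∞ := rfl

lemma phiMap_zero : phiMap α ((0 : F) : OnePoint F) = ∞ := by simp [phiMap]

lemma phiMap_coe {s : F} (hs : s ≠ 0) :
    phiMap α (s : OnePoint F) = ((s ^ 4 + α * (s ^ 4)⁻¹ : F) : OnePoint F) := by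
  simp [phiMap, hs]

lemma iterate_phiMap_infty (r : ℕ) : (phiMap α)^[r] ∞ = ∞ :=
  Function.iterate_fixed phiMap_infty r

/-- A finite escape time is realized by an orbit in `F` that reaches `0` without passing
through it before. -/
lemma exists_orbit_of_escapeTime_eq {ℓ : ℕ} (h : escapeTime α = (ℓ : ℕ∞)) :
    ∃ (n : ℕ) (t : ℕ → F), ℓ = n + 1 ∧ t 0 = 1 + α ∧ t n = 0 ∧
      ∀ j < n, t j ≠ 0 ∧ t (j + 1) = t j ^ 4 + α * (t j ^ 4)⁻¹ := by
  have hne : {n : ℕ∞ | ∃ r : ℕ, n = r ∧ 1 ≤ r ∧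
      (phiMap α)^[r] ((1 : F) : OnePoint F) = ((0 : F) : OnePoint F)}.Nonempty := by
    by_contra hem
    rw [escapeTime, Set.not_nonempty_iff_eq_empty.1 hem, sInf_empty] at h
    exact ENat.natCast_ne_top ℓ h.symm
  obtain ⟨r, hr, hr1, h0⟩ := csInf_mem hne
  rw [← escapeTime, h] at hr
  obtain rfl : ℓ = r := by exact_mod_cast hr
  set p : ℕ → OnePoint F := fun j => (phiMap α)^[j] ((1 : F) : OnePoint F) with hp
  have hsucc : ∀ j, p (j + 1) = phiMap α (p j) := fun j => Function.iterate_succ_apply' _ _ _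
  have hfin : ∀ j ≤ ℓ, p j ≠ ∞ := by
    intro j hj hinf
    obtain ⟨i, rfl⟩ := Nat.exists_eq_add_of_le hj
    have : p (j + i) = ∞ := by
      change (phiMap α)^[j + i] _ = ∞
      rw [add_comm, Function.iterate_add_apply]
      exact (congrArg _ hinf).trans (iterate_phiMap_infty i)
    exact OnePoint.coe_ne_infty _ (h0.symm.trans this)
  have hnz : ∀ j < ℓ, p j ≠ ((0 : F) : OnePoint F) := fun j hj hz =>
    hfin (j + 1) hj (by rw [hsucc, hz, phiMap_zero])
  -- The shift makes `t 0` equal φ(1) = 1 + α. The value 0 assigned to ∞ is never met before the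
  -- escape time.
  set t : ℕ → F := fun j => (p (j + 1)).elim 0 id with ht
  have hpt : ∀ j < ℓ, p (j + 1) = (t j : OnePoint F) := by
    intro j hj
    obtain ⟨s, hs⟩ := OnePoint.ne_infty_iff_exists.1 (hfin (j + 1) hj)
    rw [ht]
    simp only
    rw [← hs]
    rfl
  obtain ⟨n, rfl⟩ : ∃ n, ℓ = n + 1 := ⟨ℓ - 1, by omega⟩
  refine ⟨n, t, rfl, ?_, ?_, fun j hj => ?_⟩
  · have h1 := hpt 0 (by omega)
    rw [hsucc] at h1
    change phiMap α ((1 : F) : OnePoint F) = _ at h1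
    rw [phiMap_coe one_ne_zero, OnePoint.coe_eq_coe] at h1
    rw [← h1]; simp
  · exact OnePoint.coe_eq_coe.1 ((hpt n (by omega)).symm.trans h0)
  · have hj0 : t j ≠ 0 := fun hz => hnz (j + 1) (by omega) (by rw [hpt j (by omega), hz])
    refine ⟨hj0, ?_⟩
    have h1 := hpt (j + 1) (by omega)
    rw [hsucc, hpt j (by omega), phiMap_coe hj0, OnePoint.coe_eq_coe] at h1
    exact h1.symm

end escape

/-! ### Balanced pairs along the orbit -/

namespace LaurentPolynomial

variable {F : Type*} [Field F] {α : F}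

/-- With c₁ = α^Q t² and c₂ = α^(-Q) t², both recursions of `IsBalanced.step` become the square of t
↦ t⁴ + αt⁻⁴, squaring being additive. The step divides by c₁ and c₂, which is allowed as long as the
orbit has not reached 0. -/
lemma exists_isBalanced [CharP F 2] (hα : α ≠ 0) {n : ℕ} {t : ℕ → F} (h0 : t 0 = 1 + α)
    (ht : ∀ j < n, t j ≠ 0 ∧ t (j + 1) = t j ^ 4 + α * (t j ^ 4)⁻¹) :
    ∃ a₁ b₁ a₂ b₂ : F[T;T⁻¹],
      IsBalanced (xTail α (n + 1)) (yTail α (n + 1)) (2 * 4 ^ n)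
        (α ^ (2 * 4 ^ n) * t n ^ 2) ((α ^ (2 * 4 ^ n))⁻¹ * t n ^ 2) a₁ b₁ a₂ b₂ := by
  induction n with
  | zero => exact ⟨_, _, _, _, by simpa [h0] using isBalanced_one hα⟩
  | succ n ih =>
    obtain ⟨a₁, b₁, a₂, b₂, h⟩ := ih fun j hj => ht j (by omega)
    obtain ⟨hn, hs⟩ := ht n (by omega)
    have hp : α ^ (2 * 4 ^ n) ≠ 0 := pow_ne_zero _ hα
    have h' := h.step (α := α) (mul_ne_zero hp (pow_ne_zero 2 hn))
      (mul_ne_zero (inv_ne_zero hp) (pow_ne_zero 2 hn)) rfl rfl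
    have e : α ^ (2 * 4 ^ (n + 1)) = (α ^ (2 * 4 ^ n)) ^ 4 := by rw [← pow_mul]; ring_nf
    have sq : (t n ^ 4 + α * (t n ^ 4)⁻¹) ^ 2 = t n ^ 8 + α ^ 2 * (t n ^ 8)⁻¹ := by
      rw [CharTwo.add_sq, mul_pow, inv_pow, ← pow_mul]
    have q : (2 * 4 ^ (n + 1) : ℤ) = 4 * (2 * 4 ^ n) := by ring
    have d₁ : α ^ (2 * 4 ^ (n + 1)) * t (n + 1) ^ 2 = (α ^ (2 * 4 ^ n) * t n ^ 2) ^ 4 +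
        α ^ 2 * (((α ^ (2 * 4 ^ n))⁻¹ * t n ^ 2) ^ 4)⁻¹ := by
      rw [e, hs, sq]
      generalize α ^ (2 * 4 ^ n) = p at *
      field_simp
    have d₂ : (α ^ (2 * 4 ^ (n + 1)))⁻¹ * t (n + 1) ^ 2 = ((α ^ (2 * 4 ^ n))⁻¹ * t n ^ 2) ^ 4 +
        α ^ 2 * ((α ^ (2 * 4 ^ n) * t n ^ 2) ^ 4)⁻¹ := by
      rw [e, hs, sq]
      generalize α ^ (2 * 4 ^ n) = p at *
      field_simp
    rw [q, d₁, d₂]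
    exact ⟨_, _, _, _, h'⟩

end LaurentPolynomial

lemma add_pow_two_mul_four_pow {R : Type*} [CommRing R] (h : (2 : R) = 0) (a b : R) (k : ℕ) :
    (a + b) ^ (2 * 4 ^ k) = a ^ (2 * 4 ^ k) + b ^ (2 * 4 ^ k) := by
  induction k with
  | zero => linear_combination (a * b) * h
  | succ k ih =>
    have e : 2 * 4 ^ (k + 1) = 2 * 4 ^ k * 4 := by ring
    rw [e, pow_mul, ih, add_pow_four_of_two_eq_zero h, ← pow_mul, ← pow_mul]

/-! ### Parity and lowest term of the tail of y -/

namespace LaurentPolynomial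

variable {F : Type*} [Field F]

lemma coeff_add_apply (f g : F[T;T⁻¹]) (n : ℤ) : (f + g).coeff n = f.coeff n + g.coeff n := by
  rw [AddMonoidAlgebra.coeff_add, Finsupp.add_apply]

/-- Fourth powers and A² have even exponents, so αA⁻¹ is the only odd term. -/
lemma yTail_sub_mem_even [CharP F 2] (α : F) (k : ℕ) :
    yTail α k - C α * T (-1) ∈ supportedOn F {n | Even n} := by
  induction k with
  | zero => rw [yTail, sub_self]; exact Submodule.zero_mem _
  | succ k ih =>
    have e : yTail α (k + 1) - C α * T (-1) =
        (yTail α k - C α * T (-1)) ^ 4 + C (α ^ 4) * T (-4) + T 2 := by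
      have h4 : (T (-1) ^ 4 : F[T;T⁻¹]) = T (-4) := by simp
      rw [yTail, map_pow, ← h4, ← mul_pow, ← add_pow_four_of_two_eq_zero two_eq_zero,
        sub_add_cancel]
      ring
    rw [e]
    exact add_mem (add_mem (pow_mem_even ih 4)
      (C_mul_mem_supportedOn _ (T_mem_supportedOn (by decide)))) (T_mem_supportedOn (by decide))

lemma yTail_sub_mem_bounded [CharP F 2] (α : F) (k : ℕ) :
    yTail α k - C (α ^ 4 ^ k) * T (-4 ^ k) ∈ bounded F (-1) (4 ^ k - 1) := by
  induction k with
  | zero => simp [yTail]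
  | succ k ih =>
    have e : yTail α (k + 1) - C (α ^ 4 ^ (k + 1)) * T (-4 ^ (k + 1)) =
        (yTail α k - C (α ^ 4 ^ k) * T (-4 ^ k)) ^ 4 + (T 2 + C α * T (-1)) := by
      have h4 : (C (α ^ 4 ^ (k + 1)) * T (-4 ^ (k + 1)) : F[T;T⁻¹]) =
          (C (α ^ 4 ^ k) * T (-4 ^ k)) ^ 4 := by
        rw [mul_pow, ← map_pow, ← pow_mul, T_pow, pow_succ]
        congr 2
        push_cast
        ring
      have := add_pow_four_of_two_eq_zero (two_eq_zero (F := F))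
        (yTail α k - C (α ^ 4 ^ k) * T (-4 ^ k)) (C (α ^ 4 ^ k) * T (-4 ^ k))
      rw [sub_add_cancel] at this
      rw [yTail, h4, this]
      ring
    have h1 : (1 : ℤ) ≤ 4 ^ k := one_le_pow₀ (by norm_num)
    rw [e, pow_succ]
    exact add_mem (pow_mem_bounded ih 4 (by push_cast; omega))
      (add_mem (T_mem_bounded (by omega)) (C_mul_mem_supportedOn _ (T_mem_bounded (by omega))))

/-- The exponent in question is in general not the lowest one, so size alone does not settle it. As
a is odd and the exponent even, only the odd part αA⁻¹ of one factor of Z³ counts; it meets the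
lowest terms of Z² and of a, at exponents -2·4^k and 1 - 2·4^k. -/
lemma coeff_mul_tail_ne_zero [CharP F 2] {α : F} (hα : α ≠ 0) (k : ℕ) {a : F[T;T⁻¹]}
    (ha : a ∈ bounded F (-1) (2 * 4 ^ k - 1)) (hodd : a ∈ supportedOn F {n | Odd n})
    (hc : a.coeff (1 - 2 * 4 ^ k) ≠ 0) :
    (a * (yTail α k ^ 3 + T 1 * yTail α k)).coeff (-(4 * 4 ^ k)) ≠ 0 := by
  have hE := yTail_sub_mem_even α k
  have hr := yTail_sub_mem_bounded α k
  have h1 : (1 : ℤ) ≤ 4 ^ k := one_le_pow₀ (by norm_num)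
  generalize yTail α k = Z at *
  have hβ : α ^ 4 ^ k ≠ 0 := pow_ne_zero _ hα
  generalize α ^ 4 ^ k = β at *
  generalize (4 ^ k : ℤ) = P at *
  have hZ : Z ∈ bounded F (-1) P := by
    have := add_mem (bounded_mono (by omega) hr : _ ∈ bounded F (-1) P)
      (C_mul_mem_supportedOn β (T_mem_bounded (n := -P) (by omega)))
    rwa [sub_add_cancel] at this
  set E := Z - C α * T (-1)
  set r := Z - C β * T (-P)
  have hZ2 : Z ^ 2 = C (β ^ 2) * T (-(2 * P)) + r ^ 2 := by
    have hT : (T (-P) ^ 2 : F[T;T⁻¹]) = T (-(2 * P)) := by simp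
    rw [map_pow, ← hT]
    linear_combination (C β * T (-P) * r) * two_eq_zero (F := F)
  have hZ2e : Z ^ 2 ∈ supportedOn F {n | Even n} := by
    have e : Z ^ 2 = E ^ 2 + C (α ^ 2) * T (-2) := by
      have hT : (T (-1) ^ 2 : F[T;T⁻¹]) = T (-2) := by simp
      rw [map_pow, ← hT]
      linear_combination (C α * T (-1) * E) * two_eq_zero (F := F)
    rw [e]
    exact add_mem (pow_mem_even hE 2) (C_mul_mem_supportedOn _ (T_mem_supportedOn (by decide)))
  -- Z³ = Z²(E + αA⁻¹), and Z² is replaced by its lowest term plus r² only beside αA⁻¹. The second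
  -- summand dies by parity, the last two by size.
  have hsum : a * (Z ^ 3 + T 1 * Z) = C (β ^ 2 * α) * (T (-(2 * P) - 1) * a) +
      a * (Z ^ 2 * E) + C α * (a * (r ^ 2 * T (-1))) + a * (T 1 * Z) := by
    rw [T_sub, map_mul]
    linear_combination a * C α * T (-1) * hZ2
  have z₁ : (a * (Z ^ 2 * E)).coeff (-(4 * P)) = 0 := by
    refine coeff_eq_zero_of_mem_supportedOn (s := {n | Odd n})
      (mul_mem_supportedOn hodd (mul_mem_even hZ2e hE) fun _ h _ h' => Odd.add_even h h') ?_
    rw [Set.mem_ofPred_eq, Int.not_odd_iff_even]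
    exact ⟨-(2 * P), by ring⟩
  have z₂ : (C α * (a * (r ^ 2 * T (-1)))).coeff (-(4 * P)) = 0 := by
    refine coeff_eq_zero_of_mem_supportedOn (C_mul_mem_supportedOn α (mul_mem_bounded ha
      (mul_mem_bounded (pow_mem_bounded hr 2 le_rfl) (T_mem_bounded (m := 1) (by omega)) le_rfl)
      (le_refl _))) ?_
    rw [Set.mem_ofPred_eq]; push_cast; omega
  have z₃ : (a * (T 1 * Z)).coeff (-(4 * P)) = 0 := by
    refine coeff_eq_zero_of_mem_supportedOn (mul_mem_bounded ha
      (mul_mem_bounded (T_mem_bounded (m := -1) (by omega)) hZ le_rfl) (le_refl _)) ?_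
    rw [Set.mem_ofPred_eq]; omega
  rw [hsum, coeff_add_apply, coeff_add_apply, coeff_add_apply, z₁, z₂, z₃, add_zero, add_zero,
    add_zero, coeff_C_mul, coeff_T_mul]
  refine mul_ne_zero (mul_ne_zero (pow_ne_zero 2 hβ) hα) ?_
  convert hc using 2
  ring

end LaurentPolynomial

/-! ### Pole orders at infinity and the trace -/

namespace LaurentPolynomial

section poleBounded

variable {F : Type*} [Field F] {R : Type*} [CommRing R] [Algebra F[T;T⁻¹] R]

/-- The additive subgroup of `R` generated by the products `f * x ^ i * y ^ j` of weight at
most `m`, where `x`, `y` and the Laurent variable have weights `p`, `r` and `s`. -/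
def poleBounded (F : Type*) [Field F] {R : Type*} [CommRing R] [Algebra F[T;T⁻¹] R]
    (x y : R) (p r s m : ℤ) : AddSubgroup R :=
  AddSubgroup.closure {v | ∃ (f : F[T;T⁻¹]) (n : ℤ) (i j : ℕ), f ∈ bounded F s n ∧
    n + p * i + r * j ≤ m ∧ v = algebraMap F[T;T⁻¹] R f * (x ^ i * y ^ j)}

variable {x y : R} {p r s m n k : ℤ}

lemma mul_pow_mem_poleBounded {f : F[T;T⁻¹]} (hf : f ∈ bounded F s n) (i j : ℕ)
    (h : n + p * i + r * j ≤ m) :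
    algebraMap F[T;T⁻¹] R f * (x ^ i * y ^ j) ∈ poleBounded F x y p r s m :=
  AddSubgroup.subset_closure ⟨f, n, i, j, hf, h, rfl⟩

lemma algebraMap_mem_poleBounded {f : F[T;T⁻¹]} (hf : f ∈ bounded F s m) :
    algebraMap F[T;T⁻¹] R f ∈ poleBounded F x y p r s m := by
  simpa using mul_pow_mem_poleBounded (x := x) (y := y) (p := p) (r := r) (m := m) hf 0 0 (by simp)

lemma pow_mul_pow_mem_poleBounded (i j : ℕ) (h : p * i + r * j ≤ m) :
    x ^ i * y ^ j ∈ poleBounded F x y p r s m := by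
  have h1 : (1 : F[T;T⁻¹]) ∈ bounded F s 0 := one_mem_bounded le_rfl
  simpa using mul_pow_mem_poleBounded (x := x) (y := y) h1 i j (by rwa [zero_add])

lemma poleBounded_mono (h : m ≤ n) {v : R} (hv : v ∈ poleBounded F x y p r s m) :
    v ∈ poleBounded F x y p r s n := by
  refine AddSubgroup.closure_mono ?_ hv
  rintro _ ⟨f, l, i, j, hf, hl, rfl⟩
  exact ⟨f, l, i, j, hf, hl.trans h, rfl⟩

lemma mul_mem_poleBounded {v w : R} (hv : v ∈ poleBounded F x y p r s m)
    (hw : w ∈ poleBounded F x y p r s n) (h : m + n ≤ k) :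
    v * w ∈ poleBounded F x y p r s k := by
  refine poleBounded_mono h ?_
  induction hv using AddSubgroup.closure_induction with
  | zero => rw [zero_mul]; exact AddSubgroup.zero_mem _
  | add _ _ _ _ h₁ h₂ => rw [add_mul]; exact add_mem h₁ h₂
  | neg _ _ h₁ => rw [neg_mul]; exact neg_mem h₁
  | mem v hv =>
    obtain ⟨f, l, i, j, hf, hl, rfl⟩ := hv
    induction hw using AddSubgroup.closure_induction with
    | zero => rw [mul_zero]; exact AddSubgroup.zero_mem _
    | add _ _ _ _ h₁ h₂ => rw [mul_add]; exact add_mem h₁ h₂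
    | neg _ _ h₁ => rw [mul_neg]; exact neg_mem h₁
    | mem w hw =>
      obtain ⟨f', l', i', j', hf', hl', rfl⟩ := hw
      have e : algebraMap F[T;T⁻¹] R f * (x ^ i * y ^ j) *
          (algebraMap F[T;T⁻¹] R f' * (x ^ i' * y ^ j')) =
          algebraMap F[T;T⁻¹] R (f * f') * (x ^ (i + i') * y ^ (j + j')) := by
        rw [map_mul]; ring
      rw [e]
      refine mul_pow_mem_poleBounded (mul_mem_bounded hf hf' le_rfl) _ _ ?_
      push_cast
      linarith

lemma pow_mem_poleBounded {v : R} (hv : v ∈ poleBounded F x y p r s m) (j : ℕ)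
    (h : j * m ≤ n) : v ^ j ∈ poleBounded F x y p r s n := by
  refine poleBounded_mono h ?_
  clear h
  induction j with
  | zero => simpa using pow_mul_pow_mem_poleBounded (x := x) (y := y) 0 0 (by simp)
  | succ j ih => rw [pow_succ]; exact mul_mem_poleBounded ih hv (by push_cast; linarith)

variable {α : F} {tr : R →ₗ[F[T;T⁻¹]] F[T;T⁻¹]}

/-- The quadratic relations reduce every monomial to 1, x, y, xy without raising its weight. Only
xy, of weight 3, has nonzero trace, whence the gain of 3. The hypotheses on weights hold for the
pole orders (2, 1, 4) over A = ∞ and (1, 2, -4) over A = 0. -/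
lemma trace_pow_mul_pow_mem_bounded (hx : x ^ 2 = y + algebraMap F[T;T⁻¹] R (T 1))
    (hy : y ^ 2 = x + algebraMap F[T;T⁻¹] R (C α * T (-1))) (h1 : tr 1 = 0) (htx : tr x = 0)
    (hty : tr y = 0) (htxy : tr (x * y) = 1) (hrp : r ≤ 2 * p) (hsp : s ≤ 2 * p)
    (hpr : p ≤ 2 * r) (hsr : -s ≤ 2 * r) (h3 : p + r = 3) (i j : ℕ) :
    tr (x ^ i * y ^ j) ∈ bounded F s (p * i + r * j - 3) := by
  induction hN : i + j using Nat.strong_induction_on generalizing i j with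
  | _ N ih =>
  subst hN
  have htr : ∀ (f : F[T;T⁻¹]) (v : R), tr (algebraMap F[T;T⁻¹] R f * v) = f * tr v :=
    fun f v => by rw [← Algebra.smul_def, map_smul, smul_eq_mul]
  by_cases hi : 2 ≤ i
  · obtain ⟨i, rfl⟩ := Nat.exists_eq_add_of_le' hi
    have e : x ^ (i + 2) * y ^ j =
        x ^ i * y ^ (j + 1) + algebraMap F[T;T⁻¹] R (T 1) * (x ^ i * y ^ j) := by
      rw [pow_add x, hx]; ring
    rw [e, map_add, htr]
    refine add_mem (bounded_mono ?_ (ih _ (by omega) i (j + 1) rfl))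
      (mul_mem_bounded (T_mem_bounded (m := s) (by simp)) (ih _ (by omega) i j rfl) ?_)
    · push_cast; linarith
    · push_cast; linarith
  by_cases hj : 2 ≤ j
  · obtain ⟨j, rfl⟩ := Nat.exists_eq_add_of_le' hj
    have e : x ^ i * y ^ (j + 2) =
        x ^ (i + 1) * y ^ j + algebraMap F[T;T⁻¹] R (C α * T (-1)) * (x ^ i * y ^ j) := by
      rw [pow_add y, hy]; ring
    rw [e, map_add, htr]
    refine add_mem (bounded_mono ?_ (ih _ (by omega) (i + 1) j rfl))
      (mul_mem_bounded (C_mul_mem_supportedOn α (T_mem_bounded (m := -s) (by simp)))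
        (ih _ (by omega) i j rfl) ?_)
    · push_cast; linarith
    · push_cast; linarith
  have hi' : i = 0 ∨ i = 1 := by omega
  have hj' : j = 0 ∨ j = 1 := by omega
  rcases hi' with rfl | rfl <;> rcases hj' with rfl | rfl
  · simp [h1]
  · simp [hty]
  · simp [htx]
  · simpa [htxy] using one_mem_bounded (e := s) (by linarith)

lemma trace_mem_bounded (hx : x ^ 2 = y + algebraMap F[T;T⁻¹] R (T 1))
    (hy : y ^ 2 = x + algebraMap F[T;T⁻¹] R (C α * T (-1))) (h1 : tr 1 = 0) (htx : tr x = 0)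
    (hty : tr y = 0) (htxy : tr (x * y) = 1) (hrp : r ≤ 2 * p) (hsp : s ≤ 2 * p)
    (hpr : p ≤ 2 * r) (hsr : -s ≤ 2 * r) (h3 : p + r = 3) {v : R}
    (hv : v ∈ poleBounded F x y p r s m) : tr v ∈ bounded F s (m - 3) := by
  induction hv using AddSubgroup.closure_induction with
  | zero => rw [map_zero]; exact Submodule.zero_mem _
  | add _ _ _ _ h₁ h₂ => rw [map_add]; exact add_mem h₁ h₂
  | neg _ _ h₁ => rw [map_neg]; exact neg_mem h₁
  | mem v hv =>
    obtain ⟨f, l, i, j, hf, hl, rfl⟩ := hv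
    rw [← Algebra.smul_def, map_smul, smul_eq_mul]
    exact mul_mem_bounded hf (trace_pow_mul_pow_mem_bounded hx hy h1 htx hty htxy hrp hsp hpr hsr
      h3 i j) (by linarith)

end poleBounded

/-! ### Frobenius powers of x and y -/

section tails

lemma algebra_two_eq_zero (F : Type*) [Field F] [CharP F 2] (R : Type*) [CommRing R]
    [Algebra F[T;T⁻¹] R] : (2 : R) = 0 := by
  rw [← map_ofNat (algebraMap F[T;T⁻¹] R) 2, two_eq_zero, map_zero]

variable {F : Type*} [Field F] [CharP F 2] {R : Type*} [CommRing R] [Algebra F[T;T⁻¹] R]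
  {x y : R} {α : F}

lemma pow_four_left (hx : x ^ 2 = y + algebraMap F[T;T⁻¹] R (T 1))
    (hy : y ^ 2 = x + algebraMap F[T;T⁻¹] R (C α * T (-1))) :
    x ^ 4 = x + algebraMap F[T;T⁻¹] R (T 2 + C α * T (-1)) := by
  have hT : (T 1 ^ 2 : F[T;T⁻¹]) = T 2 := by simp
  rw [map_add, ← hT, map_pow]
  linear_combination (x ^ 2 + y + algebraMap F[T;T⁻¹] R (T 1)) * hx + hy +
    y * algebraMap F[T;T⁻¹] R (T 1) * algebra_two_eq_zero F R

lemma pow_four_right (hx : x ^ 2 = y + algebraMap F[T;T⁻¹] R (T 1))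
    (hy : y ^ 2 = x + algebraMap F[T;T⁻¹] R (C α * T (-1))) :
    y ^ 4 = y + algebraMap F[T;T⁻¹] R (T 1 + C (α ^ 2) * T (-2)) := by
  have hT : (C (α ^ 2) * T (-2) : F[T;T⁻¹]) = (C α * T (-1)) ^ 2 := by
    rw [mul_pow, map_pow]; simp
  rw [map_add, hT, map_pow]
  linear_combination (y ^ 2 + x + algebraMap F[T;T⁻¹] R (C α * T (-1))) * hy + hx +
    x * algebraMap F[T;T⁻¹] R (C α * T (-1)) * algebra_two_eq_zero F R

lemma pow_eq_add_xTail (hx : x ^ 2 = y + algebraMap F[T;T⁻¹] R (T 1))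
    (hy : y ^ 2 = x + algebraMap F[T;T⁻¹] R (C α * T (-1))) (k : ℕ) :
    x ^ (2 * 4 ^ k) = x ^ 2 + algebraMap F[T;T⁻¹] R (xTail α k) := by
  have h2 := algebra_two_eq_zero F R
  induction k with
  | zero => simp [xTail]
  | succ k ih =>
    have e : 2 * 4 ^ (k + 1) = 2 * 4 ^ k * 4 := by ring
    rw [e, pow_mul, ih, add_pow_four_of_two_eq_zero h2, xTail, map_add, map_pow, map_pow]
    have h4 := pow_four_left hx hy
    linear_combination (x ^ 4 + x + algebraMap F[T;T⁻¹] R (T 2 + C α * T (-1))) * h4 +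
      x * algebraMap F[T;T⁻¹] R (T 2 + C α * T (-1)) * h2

lemma pow_eq_add_yTail (hx : x ^ 2 = y + algebraMap F[T;T⁻¹] R (T 1))
    (hy : y ^ 2 = x + algebraMap F[T;T⁻¹] R (C α * T (-1))) (k : ℕ) :
    y ^ (2 * 4 ^ k) = x + algebraMap F[T;T⁻¹] R (yTail α k) := by
  have h2 := algebra_two_eq_zero F R
  induction k with
  | zero => simpa [yTail] using hy
  | succ k ih =>
    have e : 2 * 4 ^ (k + 1) = 2 * 4 ^ k * 4 := by ring
    rw [e, pow_mul, ih, add_pow_four_of_two_eq_zero h2, yTail, map_add, map_pow,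
      pow_four_left hx hy]
    ring

end tails

end LaurentPolynomial

/-! ### The constant coefficient of the trace, seen from each point at infinity -/

namespace LaurentPolynomial

variable {F : Type*} [Field F] {R : Type*} [CommRing R] [Algebra F[T;T⁻¹] R]
  {x y : R} {α : F} {tr : R →ₗ[F[T;T⁻¹]] F[T;T⁻¹]}

lemma mem_bounded_four_mul {f : F[T;T⁻¹]} {d e m n : ℤ} (hf : f ∈ bounded F e m) (hd : d = 4 * e)
    (h : 4 * m ≤ n) : f ∈ bounded F d n := by
  intro k hk
  have h' := hf k hk
  rw [Set.mem_ofPred_eq] at h' ⊢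
  subst hd
  linarith

lemma map_algebraMap_mul (f : F[T;T⁻¹]) (v : R) :
    tr (algebraMap F[T;T⁻¹] R f * v) = f * tr v := by
  rw [← Algebra.smul_def, map_smul, smul_eq_mul]

lemma one_mem_poleBounded {p r s m : ℤ} (h : 0 ≤ m) : 1 ∈ poleBounded F x y p r s m := by
  simpa using pow_mul_pow_mem_poleBounded (F := F) (x := x) (y := y) (p := p) (r := r)
    (s := s) (m := m) 0 0 (by simpa using h)

/-- With Z the tail of y, x + Z is y^Q, so this turns the decisive trace at A = 0 into the
expression of `coeff_mul_tail_ne_zero`. -/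
lemma trace_mul_pow_three [CharP F 2] (hx : x ^ 2 = y + algebraMap F[T;T⁻¹] R (T 1))
    (hy : y ^ 2 = x + algebraMap F[T;T⁻¹] R (C α * T (-1))) (h1 : tr 1 = 0) (htx : tr x = 0)
    (hty : tr y = 0) (htxy : tr (x * y) = 1) (Z : F[T;T⁻¹]) :
    tr (x * y * ((x + algebraMap F[T;T⁻¹] R Z) ^ 3 + 1)) = Z ^ 3 + T 1 * Z := by
  have h2 := algebra_two_eq_zero F R
  have h4 := pow_four_left hx hy
  have e : x * y * ((x + algebraMap F[T;T⁻¹] R Z) ^ 3 + 1) =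
      algebraMap F[T;T⁻¹] R (Z ^ 3 + T 1 * Z) * (x * y) +
        algebraMap F[T;T⁻¹] R (T 2 + C α * T (-1) + Z + Z ^ 2 * T 1) * y +
        algebraMap F[T;T⁻¹] R (Z * (C α * T (-1)) + Z ^ 2) * x +
        algebraMap F[T;T⁻¹] R (Z * T 1 + Z ^ 2 * (C α * T (-1))) * 1 := by
    simp only [map_add, map_mul, map_pow] at *
    generalize algebraMap F[T;T⁻¹] R (T 1) = A at *
    generalize algebraMap F[T;T⁻¹] R (T (-1)) = B at *
    generalize algebraMap F[T;T⁻¹] R (T 2) = A2 at *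
    generalize algebraMap F[T;T⁻¹] R (C α) = γ at *
    generalize algebraMap F[T;T⁻¹] R Z = Z' at *
    linear_combination y * h4 + 3 * Z' * (x * y * hx + x * hy + hx) + 3 * Z' ^ 2 * (y * hx + hy) +
      (x * y + Z' * A * x * y + Z' * y + Z' * γ * B * x + Z' * A + Z' ^ 2 * A * y +
        Z' ^ 2 * (x + γ * B)) * h2
  rw [e, map_add, map_add, map_add, map_algebraMap_mul, map_algebraMap_mul, map_algebraMap_mul,
    map_algebraMap_mul, h1, htx, hty, htxy, mul_zero, mul_zero, mul_zero, mul_one, add_zero,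
    add_zero, add_zero]

/-- Eliminating V between the relation and the syzygy writes W·l, for l = av + bu, in terms of small
quantities. Multiplying by W³ + 1 replaces W by W⁴ + W, which lies in the base ring and leaves the
trace; its top term A^(16P) carries the constant coefficient of tr l to an exponent just beyond the
pole bound. -/
lemma trace_coeff_zero_eq_zero [CharP F 2] {P : ℤ} (hP : 1 ≤ P)
    (htop : ∀ {g : R} {m : ℤ}, g ∈ poleBounded F x y 2 1 4 m → tr g ∈ bounded F 4 (m - 3))
    {a b : F[T;T⁻¹]} {γ : F} {u v w c q W V : R}
    (hW : W ^ 4 = W + algebraMap F[T;T⁻¹] R (T (16 * P) + C γ * T (-(8 * P))))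
    (ha : a ∈ bounded F 1 (2 * P - 2)) (hb : b ∈ bounded F 1 (2 * P - 1))
    (hu : u ∈ poleBounded F x y 2 1 4 (8 * P + 4)) (hv : v ∈ poleBounded F x y 2 1 4 (8 * P + 4))
    (hw : w ∈ poleBounded F x y 2 1 4 (8 * P + 4)) (hc : c ∈ poleBounded F x y 2 1 4 (8 * P - 2))
    (hq : q ∈ poleBounded F x y 2 1 4 (6 * P + 3)) (hWm : W ∈ poleBounded F x y 2 1 4 (16 * P))
    (h : u * W + v * V + w = q)
    (hsyz : algebraMap F[T;T⁻¹] R a * W + algebraMap F[T;T⁻¹] R b * V = c) :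
    (tr (algebraMap F[T;T⁻¹] R a * v + algebraMap F[T;T⁻¹] R b * u)).coeff 0 = 0 := by
  have h2 := algebra_two_eq_zero F R
  have hιa : algebraMap F[T;T⁻¹] R a ∈ poleBounded F x y 2 1 4 (8 * P - 4) :=
    algebraMap_mem_poleBounded (mem_bounded_four_mul ha (by norm_num) (by linarith))
  have hιb : algebraMap F[T;T⁻¹] R b ∈ poleBounded F x y 2 1 4 (8 * P - 4) :=
    algebraMap_mem_poleBounded (mem_bounded_four_mul hb (by norm_num) (by linarith))
  generalize algebraMap F[T;T⁻¹] R a = a' at *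
  generalize algebraMap F[T;T⁻¹] R b = b' at *
  have hlm : a' * v + b' * u ∈ poleBounded F x y 2 1 4 (16 * P) :=
    add_mem (mul_mem_poleBounded hιa hv (by linarith)) (mul_mem_poleBounded hιb hu (by linarith))
  have hid : algebraMap F[T;T⁻¹] R (T (16 * P) + C γ * T (-(8 * P))) * (a' * v + b' * u) =
      (b' * q + (v * c + b' * w)) * (W ^ 3 + 1) := by
    rw [← h]
    linear_combination (-(a' * v + b' * u)) * hW + (v * (W ^ 3 + 1)) * hsyz -
      ((a' * v + b' * u) * W + (b' * v * V + b' * w) * (W ^ 3 + 1)) * h2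
  have hmem : (b' * q + (v * c + b' * w)) * (W ^ 3 + 1) ∈
      poleBounded F x y 2 1 4 (64 * P + 2) := by
    refine mul_mem_poleBounded (m := 16 * P + 2) (n := 48 * P) (add_mem
      (mul_mem_poleBounded hιb hq (by linarith)) (add_mem (mul_mem_poleBounded hv hc
      (by linarith)) (mul_mem_poleBounded hιb hw (by linarith)))) (add_mem
      (pow_mem_poleBounded hWm 3 (by push_cast; linarith)) (one_mem_poleBounded (by linarith)))
      (by linarith)
  have z₁ : (tr ((b' * q + (v * c + b' * w)) * (W ^ 3 + 1))).coeff (16 * P) = 0 :=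
    coeff_eq_zero_of_mem_bounded (htop hmem) (by linarith)
  -- The other term of W⁴ + W would bring in this coefficient, which is far out of range.
  have z₂ : (tr (a' * v + b' * u)).coeff (24 * P) = 0 :=
    coeff_eq_zero_of_mem_bounded (htop hlm) (by linarith)
  rw [← hid, map_algebraMap_mul, add_mul, coeff_add_apply, mul_assoc, coeff_C_mul, coeff_T_mul,
    coeff_T_mul, sub_neg_eq_add, sub_self, show 16 * P + 8 * P = 24 * P by ring, z₂, mul_zero,
    add_zero] at z₁
  exact z₁

lemma coeff_pow_three_mul (γ : F) {P : ℤ} (hP : 1 ≤ P) {M : F[T;T⁻¹]}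
    (hM : M ∈ bounded F (-1) (5 * P - 1)) :
    ((T (2 * P) + C γ * T (-(4 * P))) ^ 3 * M).coeff (-(16 * P)) =
      γ ^ 3 * M.coeff (-(4 * P)) := by
  have hT : ∀ i j k : ℤ, k = i + j → (T i * T j : F[T;T⁻¹]) = T k := fun i j k h => by
    rw [h, T_add]
  have hG3 : (T (2 * P) + C γ * T (-(4 * P))) ^ 3 = C (γ ^ 3) * T (-(12 * P)) +
      (T (6 * P) + C (3 * γ) * T 0 + C (3 * γ ^ 2) * T (-(6 * P))) := by
    have e₁ := hT (2 * P) (2 * P) (4 * P) (by ring)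
    have e₂ := hT (4 * P) (2 * P) (6 * P) (by ring)
    have e₃ := hT (4 * P) (-(4 * P)) 0 (by ring)
    have e₄ := hT (-(4 * P)) (-(4 * P)) (-(8 * P)) (by ring)
    have e₅ := hT (-(8 * P)) (-(4 * P)) (-(12 * P)) (by ring)
    have e₆ := hT (2 * P) (-(8 * P)) (-(6 * P)) (by ring)
    rw [← e₂, ← e₃, ← e₅, ← e₆, ← e₁, ← e₄]
    simp only [map_mul, map_pow, map_ofNat]
    ring
  have z : ((T (6 * P) + C (3 * γ) * T 0 + C (3 * γ ^ 2) * T (-(6 * P))) * M).coeff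
      (-(16 * P)) = 0 := by
    have h : T (6 * P) + C (3 * γ) * T 0 + C (3 * γ ^ 2) * T (-(6 * P)) ∈ bounded F (-1) (6 * P) :=
      add_mem (add_mem (T_mem_bounded (by linarith))
        (C_mul_mem_supportedOn _ (T_mem_bounded (by linarith))))
        (C_mul_mem_supportedOn _ (T_mem_bounded (by linarith)))
    exact coeff_eq_zero_of_mem_bounded (mul_mem_bounded h hM le_rfl) (by linarith)
  rw [hG3, add_mul, coeff_add_apply, z, mul_assoc, coeff_C_mul, coeff_T_mul, add_zero,
    show -(16 * P) - -(12 * P) = -(4 * P) by ring]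

lemma coeff_pow_four_mul [CharP F 2] (γ : F) (P : ℤ) (L : F[T;T⁻¹]) :
    ((T (2 * P) + C γ * T (-(4 * P))) ^ 4 * L).coeff (-(16 * P)) =
      L.coeff (-(24 * P)) + γ ^ 4 * L.coeff 0 := by
  have hT : ∀ i : ℤ, (T i ^ 4 : F[T;T⁻¹]) = T (4 * i) := fun i => by simp
  rw [add_pow_four_of_two_eq_zero two_eq_zero, mul_pow, hT, hT, ← map_pow, add_mul,
    coeff_add_apply, mul_assoc, coeff_C_mul, coeff_T_mul, coeff_T_mul,
    show -(16 * P) - 4 * (2 * P) = -(24 * P) by ring,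
    show -(16 * P) - 4 * -(4 * P) = 0 by ring]

/-- Here W is eliminated instead, expressing l·z⁴ for l = av + bu. Since g = z(z³ + 1), multiplying
by (z³ + 1)⁴ turns z⁴ into g⁴, and the main term kz³ keeps one factor z³ + 1 beside g³. -/
lemma pow_four_mul_of_syzygy {S : Type*} [CommRing S] (h2 : (2 : S) = 0)
    {a b g k u v w c z W : S} (hz : z ^ 4 = z + g) (h : u * W + v * z ^ 4 + w = k * z ^ 3)
    (hsyz : a * W + b * z ^ 4 = c) :
    g ^ 4 * (a * v + b * u) + (u * c + a * w) * (z ^ 3 + 1) ^ 4 =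
      g ^ 3 * a * (k * (z ^ 3 + 1)) := by
  have hlz : (a * v + b * u) * z ^ 4 = a * (k * z ^ 3) + (u * c + a * w) := by
    linear_combination a * h + u * hsyz - (a * w + a * u * W) * h2
  have hzD : g = z * (z ^ 3 + 1) := by linear_combination -hz - z * h2
  rw [hzD]
  linear_combination (z ^ 3 + 1) ^ 4 * hlz + (u * c + a * w) * (z ^ 3 + 1) ^ 4 * h2

/-- At exponent -16P the trace of `pow_four_mul_of_syzygy` reduces to γ⁴ times the constant
coefficient of tr l on one side and γ³ times the coefficient in `htail` on the other. Everything
else lies outside the pole bounds at A = 0. -/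
lemma trace_coeff_zero_ne_zero [CharP F 2] {P : ℤ} (hP : 1 ≤ P)
    (hbot : ∀ {g : R} {m : ℤ}, g ∈ poleBounded F x y 1 2 (-4) m → tr g ∈ bounded F (-4) (m - 3))
    {a b : F[T;T⁻¹]} {γ : F} (hγ : γ ≠ 0) {u v w c z W : R}
    (hz : z ^ 4 = z + algebraMap F[T;T⁻¹] R (T (2 * P) + C γ * T (-(4 * P))))
    (ha : a ∈ bounded F (-1) (2 * P - 1)) (hb : b ∈ bounded F (-1) (2 * P - 1))
    (hu : u ∈ poleBounded F x y 1 2 (-4) (8 * P + 4))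
    (hv : v ∈ poleBounded F x y 1 2 (-4) (8 * P + 4))
    (hw : w ∈ poleBounded F x y 1 2 (-4) (8 * P + 4))
    (hc : c ∈ poleBounded F x y 1 2 (-4) (8 * P - 2))
    (hzm : z ∈ poleBounded F x y 1 2 (-4) (4 * P))
    (h : u * W + v * z ^ 4 + w = x * y * z ^ 3)
    (hsyz : algebraMap F[T;T⁻¹] R a * W + algebraMap F[T;T⁻¹] R b * z ^ 4 = c)
    (htail : (a * tr (x * y * (z ^ 3 + 1))).coeff (-(4 * P)) ≠ 0) :
    (tr (algebraMap F[T;T⁻¹] R a * v + algebraMap F[T;T⁻¹] R b * u)).coeff 0 ≠ 0 := by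
  intro h0
  have h2 := algebra_two_eq_zero F R
  have hιa : algebraMap F[T;T⁻¹] R a ∈ poleBounded F x y 1 2 (-4) (8 * P - 4) :=
    algebraMap_mem_poleBounded (mem_bounded_four_mul ha (by norm_num) (by linarith))
  have hιb : algebraMap F[T;T⁻¹] R b ∈ poleBounded F x y 1 2 (-4) (8 * P - 4) :=
    algebraMap_mem_poleBounded (mem_bounded_four_mul hb (by norm_num) (by linarith))
  have hlm : algebraMap F[T;T⁻¹] R a * v + algebraMap F[T;T⁻¹] R b * u ∈
      poleBounded F x y 1 2 (-4) (16 * P) :=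
    add_mem (mul_mem_poleBounded hιa hv (by linarith)) (mul_mem_poleBounded hιb hu (by linarith))
  have hsm : u * c + algebraMap F[T;T⁻¹] R a * w ∈ poleBounded F x y 1 2 (-4) (16 * P + 2) :=
    add_mem (mul_mem_poleBounded hu hc (by linarith)) (mul_mem_poleBounded hιa hw (by linarith))
  have hDm : z ^ 3 + 1 ∈ poleBounded F x y 1 2 (-4) (12 * P) :=
    add_mem (pow_mem_poleBounded hzm 3 (by push_cast; linarith)) (one_mem_poleBounded (by linarith))
  have hid := pow_four_mul_of_syzygy h2 hz h hsyz
  rw [← map_pow, ← map_pow, ← map_mul] at hid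
  set l := algebraMap F[T;T⁻¹] R a * v + algebraMap F[T;T⁻¹] R b * u
  set s := u * c + algebraMap F[T;T⁻¹] R a * w
  clear_value l s
  have hid' : (tr (algebraMap F[T;T⁻¹] R ((T (2 * P) + C γ * T (-(4 * P))) ^ 4) * l +
      s * (z ^ 3 + 1) ^ 4)).coeff (-(16 * P)) = (tr (algebraMap F[T;T⁻¹] R
        ((T (2 * P) + C γ * T (-(4 * P))) ^ 3 * a) * (x * y * (z ^ 3 + 1)))).coeff (-(16 * P)) := by
    rw [hid]
  rw [map_add, map_algebraMap_mul, map_algebraMap_mul, mul_assoc] at hid'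
  set M := a * tr (x * y * (z ^ 3 + 1))
  have hxy : x * y ∈ poleBounded F x y 1 2 (-4) 3 := by
    simpa using pow_mul_pow_mem_poleBounded (F := F) (x := x) (y := y) (p := 1) (r := 2)
      (s := -4) (m := 3) 1 1 (by norm_num)
  have hxyD : x * y * (z ^ 3 + 1) ∈ poleBounded F x y 1 2 (-4) (12 * P + 3) :=
    mul_mem_poleBounded hxy hDm (by linarith)
  have htD : tr (x * y * (z ^ 3 + 1)) ∈ bounded F (-1) (3 * P) := by
    have h' := hbot hxyD
    intro n hn
    have h'' := h' n hn
    rw [Set.mem_ofPred_eq] at h'' ⊢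
    linarith
  have hMm : M ∈ bounded F (-1) (5 * P - 1) := mul_mem_bounded ha htD (by linarith)
  have hsD : s * (z ^ 3 + 1) ^ 4 ∈ poleBounded F x y 1 2 (-4) (64 * P + 2) :=
    mul_mem_poleBounded hsm (pow_mem_poleBounded (n := 48 * P) hDm 4 (by push_cast; linarith))
      (by linarith)
  have z₁ : (tr (s * (z ^ 3 + 1) ^ 4)).coeff (-(16 * P)) = 0 :=
    coeff_eq_zero_of_mem_bounded (hbot hsD) (by linarith)
  have z₂ : (tr l).coeff (-(24 * P)) = 0 :=
    coeff_eq_zero_of_mem_bounded (hbot hlm) (by linarith)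
  rw [coeff_add_apply, z₁, coeff_pow_four_mul, z₂, h0, coeff_pow_three_mul γ hP hMm, mul_zero,
    add_zero, add_zero] at hid'
  exact mul_ne_zero (pow_ne_zero 3 hγ) htail hid'.symm

end LaurentPolynomial

/-! ### The contradiction on the curve -/

namespace LaurentPolynomial

variable {F : Type*} [Field F]

section

variable {R : Type*} [CommRing R] [Algebra F[T;T⁻¹] R] {x y : R} {α : F}
  {tr : R →ₗ[F[T;T⁻¹]] F[T;T⁻¹]}

/-- Applies both estimates to the same pair, with W = x^(4Q) and z = y^Q for Q = 2·4ⁿ. The syzygy's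
right-hand side a x² + b x + (aX + bY) has poles of order at most 8·4ⁿ - 2 at both points, which is
where the small size of the pair enters. -/
theorem combination_ne [CharP F 2] (hα : α ≠ 0)
    (hx : x ^ 2 = y + algebraMap F[T;T⁻¹] R (T 1))
    (hy : y ^ 2 = x + algebraMap F[T;T⁻¹] R (C α * T (-1))) (h1 : tr 1 = 0) (htx : tr x = 0)
    (hty : tr y = 0) (htxy : tr (x * y) = 1) (n : ℕ) {a b : F[T;T⁻¹]}
    (ha : a ∈ bounded F 1 (2 * 4 ^ n - 2)) (ha' : a ∈ bounded F (-1) (2 * 4 ^ n - 1))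
    (hodd : a ∈ supportedOn F {n | Odd n}) (hac : a.coeff (1 - 2 * 4 ^ n) ≠ 0)
    (hb : b ∈ bounded F 1 (2 * 4 ^ n - 1)) (hb' : b ∈ bounded F (-1) (2 * 4 ^ n - 1))
    (he : a * xTail α (n + 1) + b * yTail α (n + 1) ∈ bounded F 1 (2 * 4 ^ n - 1))
    (he' : a * xTail α (n + 1) + b * yTail α (n + 1) ∈ bounded F (-1) (2 * 4 ^ n - 1))
    {u v w : R}
    (hu : u ∈ poleBounded F x y 2 1 4 (8 * 4 ^ n + 4))
    (hu' : u ∈ poleBounded F x y 1 2 (-4) (8 * 4 ^ n + 4))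
    (hv : v ∈ poleBounded F x y 2 1 4 (8 * 4 ^ n + 4))
    (hv' : v ∈ poleBounded F x y 1 2 (-4) (8 * 4 ^ n + 4))
    (hw : w ∈ poleBounded F x y 2 1 4 (8 * 4 ^ n + 4))
    (hw' : w ∈ poleBounded F x y 1 2 (-4) (8 * 4 ^ n + 4)) :
    u * x ^ (4 * (2 * 4 ^ n)) + v * y ^ (4 * (2 * 4 ^ n)) + w ≠ x * y * (y ^ 3) ^ (2 * 4 ^ n) := by
  intro h
  have h2 := algebra_two_eq_zero F R
  have htail := coeff_mul_tail_ne_zero hα n ha' hodd hac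
  rw [← trace_mul_pow_three hx hy h1 htx hty htxy, ← pow_eq_add_yTail hx hy n] at htail
  have h4n : 4 * (2 * 4 ^ n) = 2 * 4 ^ (n + 1) := by ring
  have hT : ∀ (i k : ℤ) (j : ℕ), k = j * i → (T i ^ j : F[T;T⁻¹]) = T k :=
    fun i k j hk => by rw [hk, T_pow]
  have hW4 : (x ^ (4 * (2 * 4 ^ n))) ^ 4 = x ^ (4 * (2 * 4 ^ n)) + algebraMap F[T;T⁻¹] R
      (T (16 * 4 ^ n) + C (α ^ (2 * 4 ^ (n + 1))) * T (-(8 * 4 ^ n))) := by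
    rw [← pow_mul, mul_comm, pow_mul, pow_four_left hx hy, h4n, add_pow_two_mul_four_pow h2,
      ← map_pow, add_pow_two_mul_four_pow two_eq_zero, mul_pow, ← map_pow,
      hT 2 (16 * 4 ^ n) _ (by push_cast; ring), hT (-1) (-(8 * 4 ^ n)) _ (by push_cast; ring)]
  have hz4 : (y ^ (2 * 4 ^ n)) ^ 4 = y ^ (2 * 4 ^ n) + algebraMap F[T;T⁻¹] R
      (T (2 * 4 ^ n) + C ((α ^ 2) ^ (2 * 4 ^ n)) * T (-(4 * 4 ^ n))) := by
    rw [← pow_mul, mul_comm, pow_mul, pow_four_right hx hy, add_pow_two_mul_four_pow h2,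
      ← map_pow, add_pow_two_mul_four_pow two_eq_zero, mul_pow, ← map_pow,
      hT 1 (2 * 4 ^ n) _ (by push_cast; ring), hT (-2) (-(4 * 4 ^ n)) _ (by push_cast; ring)]
  have hsyz : algebraMap F[T;T⁻¹] R a * x ^ (4 * (2 * 4 ^ n)) +
      algebraMap F[T;T⁻¹] R b * y ^ (4 * (2 * 4 ^ n)) =
      algebraMap F[T;T⁻¹] R a * (x ^ 2 * y ^ 0) + algebraMap F[T;T⁻¹] R b * (x ^ 1 * y ^ 0) +
        algebraMap F[T;T⁻¹] R (a * xTail α (n + 1) + b * yTail α (n + 1)) := by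
    rw [h4n, pow_eq_add_xTail hx hy, pow_eq_add_yTail hx hy, map_add, map_mul, map_mul]
    ring
  have hWm : x ^ (4 * (2 * 4 ^ n)) * y ^ 0 ∈ poleBounded F x y 2 1 4 (16 * 4 ^ n) :=
    pow_mul_pow_mem_poleBounded _ _ (by push_cast; linarith)
  have hzm : x ^ 0 * y ^ (2 * 4 ^ n) ∈ poleBounded F x y 1 2 (-4) (4 * 4 ^ n) :=
    pow_mul_pow_mem_poleBounded _ _ (by push_cast; linarith)
  have hqm : x ^ 1 * y ^ (3 * (2 * 4 ^ n) + 1) ∈ poleBounded F x y 2 1 4 (6 * 4 ^ n + 3) :=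
    pow_mul_pow_mem_poleBounded _ _ (by push_cast; linarith)
  rw [pow_zero, mul_one] at hWm
  rw [pow_zero, one_mul] at hzm
  have hq : x ^ 1 * y ^ (3 * (2 * 4 ^ n) + 1) = x * y * (y ^ 3) ^ (2 * 4 ^ n) := by
    rw [pow_one, pow_succ, ← pow_mul]; ring
  have hq' : x * y * (y ^ 3) ^ (2 * 4 ^ n) = x * y * (y ^ (2 * 4 ^ n)) ^ 3 := by
    rw [← pow_mul, ← pow_mul, mul_comm 3]
  have hV : y ^ (4 * (2 * 4 ^ n)) = (y ^ (2 * 4 ^ n)) ^ 4 := by rw [← pow_mul, mul_comm]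
  rw [hq] at hqm
  have hP : (1 : ℤ) ≤ 4 ^ n := one_le_pow₀ (by norm_num)
  generalize (4 ^ n : ℤ) = P at *
  generalize x ^ (4 * (2 * 4 ^ n)) = W at *
  have hcm := add_mem (add_mem
    (mul_pow_mem_poleBounded (x := x) (y := y) (p := 2) (r := 1) (s := 4) (m := 8 * P - 2)
      (mem_bounded_four_mul ha (by norm_num) le_rfl) 2 0 (by push_cast; linarith))
    (mul_pow_mem_poleBounded (mem_bounded_four_mul hb (by norm_num) le_rfl) 1 0
      (by push_cast; linarith)))
    (algebraMap_mem_poleBounded (mem_bounded_four_mul he (by norm_num) (by linarith)))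
  have hcm' := add_mem (add_mem
    (mul_pow_mem_poleBounded (x := x) (y := y) (p := 1) (r := 2) (s := -4) (m := 8 * P - 2)
      (mem_bounded_four_mul ha' (by norm_num) le_rfl) 2 0 (by push_cast; linarith))
    (mul_pow_mem_poleBounded (mem_bounded_four_mul hb' (by norm_num) le_rfl) 1 0
      (by push_cast; linarith)))
    (algebraMap_mem_poleBounded (mem_bounded_four_mul he' (by norm_num) (by linarith)))
  rw [← hsyz] at hcm hcm'
  have hl0 := trace_coeff_zero_eq_zero hP (fun hg => trace_mem_bounded hx hy h1 htx hty htxy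
    (by norm_num) (by norm_num) (by norm_num) (by norm_num) (by norm_num) hg)
    hW4 ha hb hu hv hw hcm hqm hWm h rfl
  rw [hq', hV] at h
  rw [hV] at hcm'
  exact trace_coeff_zero_ne_zero hP (fun hg => trace_mem_bounded hx hy h1 htx hty htxy
    (by norm_num) (by norm_num) (by norm_num) (by norm_num) (by norm_num) hg)
    (pow_ne_zero _ (pow_ne_zero 2 hα)) hz4 ha' hb' hu' hv' hw' hcm' hzm h rfl htail hl0

end

/-- Once c₁ = 0, the first pair is off centre: the exponent Q is attained at the top, but nothing
lies below 2 - Q. Multiplying by A⁻¹ centres it in [1 - Q, Q - 1] and makes the even a₁ odd. -/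
lemma IsBalanced.exists_odd [CharP F 2] {X Y a₁ b₁ a₂ b₂ : F[T;T⁻¹]} {Q : ℤ} {c₂ : F}
    (h : IsBalanced X Y Q 0 c₂ a₁ b₁ a₂ b₂) :
    ∃ a b : F[T;T⁻¹], a ∈ bounded F 1 (Q - 2) ∧ a ∈ bounded F (-1) (Q - 1) ∧
      a ∈ supportedOn F {n | Odd n} ∧ a.coeff (1 - Q) ≠ 0 ∧
      b ∈ bounded F 1 (Q - 1) ∧ b ∈ bounded F (-1) (Q - 1) ∧
      a * X + b * Y ∈ bounded F 1 (Q - 1) ∧ a * X + b * Y ∈ bounded F (-1) (Q - 1) := by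
  have hT : (T (-1) : F[T;T⁻¹]) ∈ bounded F 1 (-1) := T_mem_bounded (by norm_num)
  have hT' : (T (-1) : F[T;T⁻¹]) ∈ bounded F (-1) 1 := T_mem_bounded (by norm_num)
  have hb : b₁ ∈ bounded F 1 Q := by
    have := add_mem (bounded_mono (by linarith) h.b₁_top : _ ∈ bounded F 1 Q)
      (T_mem_bounded (n := Q) (by linarith))
    rwa [sub_add_cancel] at this
  have he := h.e₁_bot
  rw [map_zero, zero_mul, sub_zero] at he
  have e : T (-1) * a₁ * X + T (-1) * b₁ * Y = T (-1) * (a₁ * X + b₁ * Y) := by ring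
  refine ⟨T (-1) * a₁, T (-1) * b₁, mul_mem_bounded hT h.a₁_top (by linarith),
    mul_mem_bounded hT' h.a₁_bot (by linarith), ?_, ?_, mul_mem_bounded hT hb (by linarith),
    mul_mem_bounded hT' h.b₁_bot (by linarith), ?_, ?_⟩
  · exact mul_mem_supportedOn (T_mem_supportedOn (s := {n | Odd n}) (by decide)) h.a₁_even
      fun _ h _ h' => Odd.add_even h h'
  · rw [coeff_T_mul]
    convert h.a₁_coeff using 2
    ring
  · rw [e]; exact mul_mem_bounded hT h.e₁_top (by linarith)
  · rw [e]; exact mul_mem_bounded hT' he (by linarith)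

/-- The extension `x ^ 4 + x = A ^ 2 + α * A⁻¹` of the Laurent polynomials in `A`, with
`y = x ^ 2 + A` and the linear form reading off the coefficient of `x ^ 3`. -/
lemma exists_extension [CharP F 2] (α : F) :
    ∃ (g : Polynomial F[T;T⁻¹]) (x y : AdjoinRoot g) (tr : AdjoinRoot g →ₗ[F[T;T⁻¹]] F[T;T⁻¹]),
      x ^ 2 = y + algebraMap F[T;T⁻¹] (AdjoinRoot g) (T 1) ∧
      y ^ 2 = x + algebraMap F[T;T⁻¹] (AdjoinRoot g) (C α * T (-1)) ∧
      tr 1 = 0 ∧ tr x = 0 ∧ tr y = 0 ∧ tr (x * y) = 1 := by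
  set g : Polynomial F[T;T⁻¹] :=
    Polynomial.X ^ 4 + (Polynomial.X + Polynomial.C (T 2 + C α * T (-1))) with hg
  have hdeg : (Polynomial.X + Polynomial.C (T 2 + C α * T (-1)) : Polynomial F[T;T⁻¹]).degree <
      (4 : ℕ) := by
    rw [Polynomial.degree_X_add_C]; norm_num
  have hm : g.Monic := Polynomial.monic_X_pow_add hdeg
  have hgd : g.degree = (4 : ℕ) := by
    rw [hg, Polynomial.degree_add_eq_left_of_degree_lt] <;> rw [Polynomial.degree_X_pow]
    exact hdeg
  have hroot : AdjoinRoot.root g ^ 4 + (AdjoinRoot.root g +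
      algebraMap F[T;T⁻¹] (AdjoinRoot g) (T 2 + C α * T (-1))) = 0 := by
    have := AdjoinRoot.eval₂_root g
    rw [hg] at this
    simpa [-map_add, -map_mul] using this
  have h2 := algebra_two_eq_zero F (AdjoinRoot g)
  -- By Euler's formula this is the trace of the extension, as the derivative of x⁴ + x + c is 1 in
  -- characteristic 2.
  let tr : AdjoinRoot g →ₗ[F[T;T⁻¹]] F[T;T⁻¹] :=
    (Polynomial.lcoeff F[T;T⁻¹] 3).comp (AdjoinRoot.modByMonicHom hm)
  have htr : ∀ p : Polynomial F[T;T⁻¹], p.degree < (4 : ℕ) →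
      tr (AdjoinRoot.mk g p) = p.coeff 3 := by
    intro p hp
    have := (Polynomial.modByMonic_eq_self_iff hm).2 (hgd ▸ hp)
    simp [tr, AdjoinRoot.modByMonicHom_mk, this]
  have hT2 : (T 1 ^ 2 : F[T;T⁻¹]) = T 2 := by simp
  refine ⟨g, AdjoinRoot.root g,
    AdjoinRoot.root g ^ 2 - algebraMap F[T;T⁻¹] (AdjoinRoot g) (T 1), tr, by ring, ?_, ?_, ?_,
    ?_, ?_⟩
  · rw [map_add, ← hT2, map_pow] at hroot
    linear_combination hroot - (AdjoinRoot.root g + AdjoinRoot.root g ^ 2 *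
      algebraMap F[T;T⁻¹] (AdjoinRoot g) (T 1) +
      algebraMap F[T;T⁻¹] (AdjoinRoot g) (C α * T (-1))) * h2
  · have := htr 1 (by rw [Polynomial.degree_one]; norm_num)
    rw [map_one] at this
    rw [this, Polynomial.coeff_one]; norm_num
  · have := htr Polynomial.X (by rw [Polynomial.degree_X]; norm_num)
    rw [AdjoinRoot.mk_X] at this
    rw [this, Polynomial.coeff_X]; norm_num
  · have := htr (Polynomial.X ^ 2 - Polynomial.C (T 1)) (by
      rw [Polynomial.degree_X_pow_sub_C (by norm_num)]; norm_num)
    rw [map_sub, map_pow, AdjoinRoot.mk_X, AdjoinRoot.mk_C] at this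
    rw [AdjoinRoot.algebraMap_eq, this, Polynomial.coeff_sub, Polynomial.coeff_X_pow,
      Polynomial.coeff_C]; norm_num
  · have := htr (Polynomial.X ^ 3 - Polynomial.C (T 1) * Polynomial.X) (by
      rw [Polynomial.degree_sub_eq_left_of_degree_lt] <;> rw [Polynomial.degree_X_pow]
      · norm_num
      · exact (Polynomial.degree_C_mul_X_le _).trans_lt (by norm_num))
    rw [map_sub, map_mul, map_pow, AdjoinRoot.mk_X, AdjoinRoot.mk_C] at this
    have e : AdjoinRoot.root g * (AdjoinRoot.root g ^ 2 -
        algebraMap F[T;T⁻¹] (AdjoinRoot g) (T 1)) = AdjoinRoot.root g ^ 3 -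
          AdjoinRoot.of g (T 1) * AdjoinRoot.root g := by
      rw [AdjoinRoot.algebraMap_eq]; ring
    rw [e, this, Polynomial.coeff_sub, Polynomial.coeff_X_pow, Polynomial.coeff_C_mul,
      Polynomial.coeff_X]; norm_num

end LaurentPolynomial

/-! ### From polynomials in three variables to the curve -/

section homogenization

variable {F : Type*} [Field F] {R : Type*} [CommRing R] [Algebra F[T;T⁻¹] R]

/-- The ring homomorphism to `R[U]` sending the three variables to `x * U`, `y * U` and `U`. -/
noncomputable def gradedEval (F : Type*) [Field F] {R : Type*} [CommRing R] [Algebra F[T;T⁻¹] R]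
    (x y : R) : MvPolynomial (Fin 3) F →+* Polynomial R :=
  eval₂Hom (Polynomial.C.comp ((algebraMap F[T;T⁻¹] R).comp LaurentPolynomial.C))
    ![Polynomial.C x * Polynomial.X, Polynomial.C y * Polynomial.X, Polynomial.X]

variable {x y : R}

lemma gradedEval_C (c : F) : gradedEval F x y (C c) =
    Polynomial.C (algebraMap F[T;T⁻¹] R (LaurentPolynomial.C c)) := by simp [gradedEval]

lemma gradedEval_X_zero : gradedEval F x y (X 0) = Polynomial.C x * Polynomial.X := by
  simp [gradedEval]

lemma gradedEval_X_one : gradedEval F x y (X 1) = Polynomial.C y * Polynomial.X := by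
  simp [gradedEval]

lemma gradedEval_X_two : gradedEval F x y (X 2) = Polynomial.X := by
  simp [gradedEval]

/-- The coefficient of Uⁿ combines monomials xⁱyʲ with i + j ≤ n, and x, y have weight at most 2. -/
lemma coeff_gradedEval_mem_poleBounded {p r s : ℤ} (hp : p ≤ 2) (hr : r ≤ 2)
    (f : MvPolynomial (Fin 3) F) (n : ℕ) :
    (gradedEval F x y f).coeff n ∈ LaurentPolynomial.poleBounded F x y p r s (2 * n) := by
  induction f using MvPolynomial.induction_on' with
  | add f g hf hg => rw [map_add, Polynomial.coeff_add]; exact add_mem hf hg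
  | monomial d c =>
    have e : gradedEval F x y (monomial d c) = Polynomial.C
        (algebraMap F[T;T⁻¹] R (LaurentPolynomial.C c) * (x ^ d 0 * y ^ d 1)) *
          Polynomial.X ^ (d 0 + d 1 + d 2) := by
      rw [gradedEval, coe_eval₂Hom, eval₂_monomial, Finsupp.prod_fintype _ _ (by simp),
        Fin.prod_univ_three]
      simp only [RingHom.comp_apply, Matrix.cons_val_zero, Matrix.cons_val_one, Matrix.cons_val,
        map_mul, map_pow]
      ring
    rw [e, Polynomial.coeff_C_mul_X_pow]
    split_ifs with h
    · refine LaurentPolynomial.mul_pow_mem_poleBounded (n := 0) ?_ _ _ ?_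
      · rw [← mul_one (LaurentPolynomial.C c)]
        exact LaurentPolynomial.C_mul_mem_supportedOn c (LaurentPolynomial.one_mem_bounded le_rfl)
      · subst h
        push_cast
        nlinarith [mul_le_mul_of_nonneg_right hp (Nat.cast_nonneg (α := ℤ) (d 0)),
          mul_le_mul_of_nonneg_right hr (Nat.cast_nonneg (α := ℤ) (d 1)),
          Nat.cast_nonneg (α := ℤ) (d 2)]
    · exact AddSubgroup.zero_mem _

lemma gradedEval_hQuartic [CharP F 2] {α : F}
    (hx : x ^ 2 = y + algebraMap F[T;T⁻¹] R (LaurentPolynomial.T 1))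
    (hy : y ^ 2 = x + algebraMap F[T;T⁻¹] R (LaurentPolynomial.C α * LaurentPolynomial.T (-1))) :
    gradedEval F x y (hQuartic α) = 0 := by
  have h2 := LaurentPolynomial.algebra_two_eq_zero F R
  have hT : (LaurentPolynomial.T 1 * LaurentPolynomial.T (-1) : F[T;T⁻¹]) = 1 := by
    rw [← LaurentPolynomial.T_add]; simp
  have hA := congrArg (algebraMap F[T;T⁻¹] R) hT
  rw [map_mul, map_one] at hA
  rw [map_mul] at hy
  have key : algebraMap F[T;T⁻¹] R (LaurentPolynomial.C α) + (x ^ 2 + y) * (y ^ 2 + x) = 0 := by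
    rw [hx, hy]
    generalize algebraMap F[T;T⁻¹] R (LaurentPolynomial.T 1) = A at *
    generalize algebraMap F[T;T⁻¹] R (LaurentPolynomial.T (-1)) = B at *
    generalize algebraMap F[T;T⁻¹] R (LaurentPolynomial.C α) = c at *
    linear_combination c * hA + (2 * y * x + y * c * B + A * x + c) * h2
  have e : gradedEval F x y (hQuartic α) = Polynomial.C
      (algebraMap F[T;T⁻¹] R (LaurentPolynomial.C α) + (x ^ 2 + y) * (y ^ 2 + x)) *
        Polynomial.X ^ 4 := by
    rw [hQuartic]
    simp only [map_add, map_mul, map_pow, gradedEval_C, gradedEval_X_zero, gradedEval_X_one,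
      gradedEval_X_two]
    ring
  rw [e, key, map_zero, zero_mul]

end homogenization

lemma exists_eq_of_mk_mem_span {F : Type*} [Field F] {m : ℕ} {h v : MvPolynomial (Fin 3) F}
    (hv : Ideal.Quotient.mk (powerIdeal F m) v ∈
      Ideal.span {Ideal.Quotient.mk (powerIdeal F m) h}) :
    ∃ a b c d : MvPolynomial (Fin 3) F,
      v = h * d + (a * X 0 ^ m + b * X 1 ^ m + c * X 2 ^ m) := by
  obtain ⟨d, hd⟩ := Ideal.mem_span_singleton.1 hv
  obtain ⟨d, rfl⟩ := Ideal.Quotient.mk_surjective d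
  rw [← map_mul, Ideal.Quotient.eq, powerIdeal, Ideal.mem_span_insert] at hd
  obtain ⟨a, z, hz, hd⟩ := hd
  obtain ⟨b, c, rfl⟩ := Ideal.mem_span_pair.1 hz
  exact ⟨a, b, c, d, by linear_combination hd⟩

theorem mainTheorem3 {F : Type*} [Field F] [IsAlgClosed F] [CharP F 2] (α : F) (hα : α ≠ 0)
    (ℓ : ℕ) (hℓ : escapeTime α = (ℓ : ℕ∞)) (Q : ℕ) (hQ : Q = 2 ^ (2 * ℓ - 1)) :
    Ideal.Quotient.mk (powerIdeal F (4 * Q)) (X 0 * X 1 * (X 1 ^ 3 * X 2 ^ 3) ^ Q) ∉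
      Ideal.span {Ideal.Quotient.mk (powerIdeal F (4 * Q)) (hQuartic α)} := by
  intro hmem
  obtain ⟨f₀, f₁, f₂, d, hf⟩ := exists_eq_of_mk_mem_span hmem
  obtain ⟨n, t, rfl, ht0, htn, ht⟩ := exists_orbit_of_escapeTime_eq hℓ
  obtain ⟨a₁, b₁, a₂, b₂, hbal⟩ := LaurentPolynomial.exists_isBalanced hα ht0 ht
  rw [htn, zero_pow two_ne_zero, mul_zero] at hbal
  obtain ⟨a, b, ha, ha', hodd, hac, hb, hb', he, he'⟩ := hbal.exists_odd
  obtain ⟨g, x, y, tr, hx, hy, h1, htx, hty, htxy⟩ := LaurentPolynomial.exists_extension α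
  -- The orbit is indexed from φ(1), so ℓ = n + 1 and 2ℓ - 1 = 2n + 1.
  obtain rfl : Q = 2 * 4 ^ n := by
    rw [hQ, show 2 * (n + 1) - 1 = 2 * n + 1 by omega, pow_succ, pow_mul, mul_comm]; norm_num
  have hm : ∀ f, (gradedEval F x y f).coeff (2 * (2 * 4 ^ n) + 2) ∈
      LaurentPolynomial.poleBounded F x y 2 1 4 (8 * 4 ^ n + 4) := fun f => by
    have := coeff_gradedEval_mem_poleBounded (x := x) (y := y) (p := 2) (r := 1) (s := 4)
      (by norm_num) (by norm_num) f (2 * (2 * 4 ^ n) + 2)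
    exact LaurentPolynomial.poleBounded_mono (by push_cast; linarith) this
  have hm' : ∀ f, (gradedEval F x y f).coeff (2 * (2 * 4 ^ n) + 2) ∈
      LaurentPolynomial.poleBounded F x y 1 2 (-4) (8 * 4 ^ n + 4) := fun f => by
    have := coeff_gradedEval_mem_poleBounded (x := x) (y := y) (p := 1) (r := 2) (s := -4)
      (by norm_num) (by norm_num) f (2 * (2 * 4 ^ n) + 2)
    exact LaurentPolynomial.poleBounded_mono (by push_cast; linarith) this
  refine LaurentPolynomial.combination_ne hα hx hy h1 htx hty htxy n ha ha' hodd hac hb hb' he he'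
    (hm f₀) (hm' f₀) (hm f₁) (hm' f₁) (hm f₂) (hm' f₂) ?_
  generalize 2 * 4 ^ n = q at *
  -- The cofactors need not be homogeneous; this power of U selects degree 6Q + 2 of the identity,
  -- and with it degree 2Q + 2 of each cofactor.
  have hcoeff := congrArg (fun f => (gradedEval F x y f).coeff (2 * q + 2 + 4 * q)) hf
  simp only [map_add, map_mul, map_pow, gradedEval_hQuartic hx hy, gradedEval_X_zero,
    gradedEval_X_one, gradedEval_X_two, zero_mul, zero_add] at hcoeff
  have eL : Polynomial.C x * Polynomial.X * (Polynomial.C y * Polynomial.X) *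
      ((Polynomial.C y * Polynomial.X) ^ 3 * Polynomial.X ^ 3) ^ q =
      Polynomial.C (x * y * (y ^ 3) ^ q) * Polynomial.X ^ (2 * q + 2 + 4 * q) := by
    simp only [map_mul, map_pow]
    ring
  have eR : ∀ (p : Polynomial (AdjoinRoot g)) (z : AdjoinRoot g),
      p * (Polynomial.C z * Polynomial.X) ^ (4 * q) =
        p * Polynomial.C (z ^ (4 * q)) * Polynomial.X ^ (4 * q) := fun p z => by
    rw [mul_pow, map_pow, mul_assoc]
  rw [eL, eR, eR, Polynomial.coeff_C_mul_X_pow, if_pos rfl, Polynomial.coeff_add,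
    Polynomial.coeff_add, Polynomial.coeff_mul_X_pow, Polynomial.coeff_mul_X_pow,
    Polynomial.coeff_mul_X_pow, Polynomial.coeff_mul_C, Polynomial.coeff_mul_C] at hcoeff
  exact hcoeff.symm
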